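/- Let $d\ge 1$, let $\|s\|_1=\sum_{i=1}^d|s_i|$, let $\mathcal S=\{s\in[0,1]^d:\|s\|_1\le 1\}$, and for $\delta>0$ let $\mathcal S_\delta=\{s\in\mathcal S: 1-\|s\|_1\ge\delta,\ s_i\ge\delta\text{ for all }i\}$. For $\alpha\in(0,\infty)^d$ and $\beta>0$ let $$K_{\alpha,\beta}(x)=\frac{\Gamma(\|\alpha\|_1+\beta)}{\Gamma(\beta)\prod_{i=1}^d\Gamma(\alpha_i)}\,(1-\|x\|_1)^{\beta-1}\prod_{i=1}^d x_i^{\alpha_i-1},\qquad x\in\mathcal S,$$ be the Dirichlet density. Let $f$ be a probability density on $\mathcal S$, let $X_1,X_2,\dots$ be i.i.d. random vectors with density $f$, and for $n\ge 1$, $b>0$ and $s\in\mathcal S$ set $$\hat f_{n,b}(s)=\frac1n\sum_{i=1}^n K_{s/b+1,\,(1-\|s\|_1)/b+1}(X_i),\qquad f_b(s)=\mathbb E[\hat f_{n,b}(s)]=\mathbb E\big[K_{s/b+1,\,(1-\|s\|_1)/b+1}(X_1)\big].$$ **Theorem (Uniform strong consistency).** Assume that $f$ is Lipschitz continuous on $\mathcal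 S$. 1. There is a constant $C$, depending only on $f$ and $d$, such that for all sufficiently small $b>0$, $$\sup_{s\in\mathcal S}|f_b(s)-f(s)|\le C\,b^{1/2}.$$ 2. There is a constant $C$, depending only on $f$ and $d$, such that for every sequence of bandwidths $b=b(n)>0$ with $b\to0$ as $n\to\infty$ and $b^{-d}\le n$ for all large $n$, almost surely, for all sufficiently large $n$ (how large may depend on the outcome), $$\sup_{s\in\mathcal S_{bd}}|\hat f_{n,b}(s)-f(s)|\le C\,\frac{|\log b|\,(\log n)^{3/2}}{b^{d+1/2}\sqrt n}+C\,b^{1/2}.$$ 3. In particular, for every sequence $b=b(n)>0$ with $b\to0$ and $|\log b|^2\,b^{-2d-1}=o\big(n/(\log n)^3\big)$ as $n\to\infty$, $$\sup_{s\in\mathcal S_{bd}}|\hat f_{n,b}(s)-f(s)|\to0\quad\text{almost surely}.$$ -/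

import Mathlib

open MeasureTheory ProbabilityTheory Filter Topology
open scoped ENNReal

universe u

noncomputable section

namespace DirichletKernel

variable {d : ℕ}

/-- The `ℓ¹` norm `‖s‖₁ = ∑ᵢ |sᵢ|` on `ℝᵈ`. -/
def l1norm (s : Fin d → ℝ) : ℝ := ∑ i, |s i|

/-- The `d`-dimensional simplex `{s ∈ [0,1]ᵈ : ‖s‖₁ ≤ 1}`. -/
def simplex (d : ℕ) : Set (Fin d → ℝ) :=
  {s | (∀ i, s i ∈ Set.Icc (0 : ℝ) 1) ∧ l1norm s ≤ 1}

/-- The shrunk simplex `{s ∈ 𝒮 : 1 - ‖s‖₁ ≥ δ and sᵢ ≥ δ for all i}`. -/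
def shrunkSimplex (d : ℕ) (δ : ℝ) : Set (Fin d → ℝ) :=
  {s | s ∈ simplex d ∧ δ ≤ 1 - l1norm s ∧ ∀ i, δ ≤ s i}

/-- The density of the `Dirichlet(α, β)` distribution, as a function of `x ∈ 𝒮`. -/
def dirichletDensity (α : Fin d → ℝ) (β : ℝ) (x : Fin d → ℝ) : ℝ :=
  Real.Gamma (l1norm α + β) / (Real.Gamma β * ∏ i, Real.Gamma (α i)) *
    ((1 - l1norm x) ^ (β - 1) * ∏ i, x i ^ (α i - 1))

/-- The Dirichlet kernel with bandwidth `b` at the point `s`, namely the density of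
`Dirichlet(s / b + 1, (1 - ‖s‖₁) / b + 1)`. -/
def kernel (b : ℝ) (s x : Fin d → ℝ) : ℝ :=
  dirichletDensity (fun i => s i / b + 1) ((1 - l1norm s) / b + 1) x

/-- `f` is a probability density on the simplex (its values off the simplex play no role). -/
structure IsDensity (f : (Fin d → ℝ) → ℝ) : Prop where
  nonneg : ∀ s ∈ simplex d, 0 ≤ f s
  lintegral_eq_one : ∫⁻ x in simplex d, ENNReal.ofReal (f x) = 1

/-- The distribution `F` on `ℝᵈ` whose Lebesgue density is `f` on the simplex and `0` elsewhere. -/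
def law (f : (Fin d → ℝ) → ℝ) : Measure (Fin d → ℝ) :=
  (volume.restrict (simplex d)).withDensity (fun x => ENNReal.ofReal (f x))

/-- `X 0, X 1, …` are i.i.d. random vectors with density `f` supported on the simplex. -/
structure IsSample {Ω : Type u} [MeasurableSpace Ω] (P : Measure Ω)
    (f : (Fin d → ℝ) → ℝ) (X : ℕ → Ω → Fin d → ℝ) : Prop where
  measurable : ∀ i, Measurable (X i)
  indep : iIndepFun X P
  map_eq : ∀ i, P.map (X i) = law f

/-- The Dirichlet kernel estimator `f̂_{n,b}(s)` built from the first `n` observations. -/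
def estimator {Ω : Type u} (X : ℕ → Ω → Fin d → ℝ) (n : ℕ) (b : ℝ) (ω : Ω)
    (s : Fin d → ℝ) : ℝ :=
  1 / (n : ℝ) * ∑ i ∈ Finset.range n, kernel b s (X i ω)

/-- `f_b(s) = 𝔼[K_{s/b+1, (1-‖s‖₁)/b+1}(X)]` with `X` distributed according to `F`; see
`integral_estimator` for the equality with the expectation of the estimator. -/
def smoothed (f : (Fin d → ℝ) → ℝ) (b : ℝ) (s : Fin d → ℝ) : ℝ :=
  ∫ x, kernel b s x ∂(law f)

/-- The supremum `sup_{s ∈ A} |g s - h s|`, as an extended non-negative real. -/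
def supDist (A : Set (Fin d → ℝ)) (g h : (Fin d → ℝ) → ℝ) : ℝ≥0∞ :=
  ⨆ s ∈ A, ENNReal.ofReal |g s - h s|

theorem measurable_kernel (b : ℝ) (s : Fin d → ℝ) : Measurable (kernel b s) := by
  unfold kernel dirichletDensity l1norm
  refine Measurable.const_mul (Measurable.mul ?_ ?_) _
  · exact (measurable_const.sub (Finset.measurable_sum _
      fun i _ => (measurable_pi_apply i).abs)).pow_const _
  · exact Finset.measurable_prod _ fun i _ => (measurable_pi_apply i).pow_const _

theorem measurableSet_simplex : MeasurableSet (simplex d) := by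
  have h : simplex d = (⋂ i, {s : Fin d → ℝ | s i ∈ Set.Icc (0 : ℝ) 1}) ∩ {s | l1norm s ≤ 1} := by
    ext s; simp [simplex]
  rw [h]
  refine MeasurableSet.inter (MeasurableSet.iInter fun i => measurable_pi_apply i measurableSet_Icc)
    (measurableSet_le ?_ measurable_const)
  exact Finset.measurable_sum _ fun i _ => (measurable_pi_apply i).abs

theorem IsDensity.isProbabilityMeasure {f : (Fin d → ℝ) → ℝ} (hf : IsDensity f) :
    IsProbabilityMeasure (law f) :=
  ⟨by rw [law, withDensity_apply _ MeasurableSet.univ, Measure.restrict_univ,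
    hf.lintegral_eq_one]⟩

theorem integrable_kernel {f : (Fin d → ℝ) → ℝ} (hf : IsDensity f) {b : ℝ} (hb : 0 < b)
    {s : Fin d → ℝ} (hs : s ∈ simplex d) : Integrable (kernel b s) (law f) := by
  have := hf.isProbabilityMeasure
  set c := Real.Gamma (l1norm (fun i => s i / b + 1) + ((1 - l1norm s) / b + 1)) /
    (Real.Gamma ((1 - l1norm s) / b + 1) * ∏ i, Real.Gamma (s i / b + 1)) with hc
  refine Integrable.of_bound (measurable_kernel b s).aestronglyMeasurable |c| ?_
  have hmem : ∀ᵐ x ∂(law f), x ∈ simplex d :=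
    (withDensity_absolutelyContinuous _ _).ae_le (ae_restrict_mem measurableSet_simplex)
  filter_upwards [hmem] with x hx
  have h0 : 0 ≤ l1norm x := Finset.sum_nonneg fun i _ => abs_nonneg _
  have h1 : |(1 - l1norm x) ^ ((1 - l1norm s) / b + 1 - 1)| ≤ 1 := by
    have hx1 := hx.2
    have hs1 := hs.2
    rw [abs_of_nonneg (Real.rpow_nonneg (by linarith) _)]
    refine Real.rpow_le_one (by linarith) (by linarith) ?_
    have : 0 ≤ (1 - l1norm s) / b := div_nonneg (by linarith) hb.le
    linarith
  have h2 : |∏ i, x i ^ (s i / b + 1 - 1)| ≤ 1 := by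
    rw [Finset.abs_prod]
    refine Finset.prod_le_one (fun i _ => abs_nonneg _) fun i _ => ?_
    rw [abs_of_nonneg (Real.rpow_nonneg (hx.1 i).1 _)]
    refine Real.rpow_le_one (hx.1 i).1 (hx.1 i).2 ?_
    have : 0 ≤ s i / b := div_nonneg (hs.1 i).1 hb.le
    linarith
  rw [Real.norm_eq_abs, kernel, dirichletDensity, ← hc, abs_mul, abs_mul]
  calc _ ≤ |c| * (1 * 1) := by gcongr
    _ = |c| := by ring

/-- The function `f_b` is the expectation of the Dirichlet kernel estimator. -/
theorem integral_estimator {Ω : Type u} [MeasurableSpace Ω] {P : Measure Ω}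
    {f : (Fin d → ℝ) → ℝ} (hf : IsDensity f) {X : ℕ → Ω → Fin d → ℝ} (hX : IsSample P f X)
    {n : ℕ} (hn : 1 ≤ n) {b : ℝ} (hb : 0 < b) {s : Fin d → ℝ} (hs : s ∈ simplex d) :
    ∫ ω, estimator X n b ω s ∂P = smoothed f b s := by
  have hint : ∀ i, Integrable (fun ω => kernel b s (X i ω)) P := fun i => by
    have h := integrable_kernel hf hb hs
    rw [← hX.map_eq i] at h
    exact h.comp_measurable (hX.measurable i)
  have heq : ∀ i, ∫ ω, kernel b s (X i ω) ∂P = smoothed f b s := fun i => by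
    rw [smoothed, ← hX.map_eq i, integral_map (hX.measurable i).aemeasurable
      (measurable_kernel b s).aestronglyMeasurable]
  have hn' : (n : ℝ) ≠ 0 := by positivity
  simp only [estimator]
  rw [integral_const_mul, integral_finsetSum _ fun i _ => hint i]
  simp only [heq, Finset.sum_const, Finset.card_range, nsmul_eq_mul]
  field_simp

end DirichletKernel

end

/-! The error splits into the bias `f_b - f` and the stochastic part `f̂ - f_b`.

Bias. Multiplying the kernel by a power of one coordinate only shifts a Dirichlet parameter, so the
Dirichlet integral (`lintegral_dirichlet`) yields exact moments. A vector with the kernel's law at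
`s` then has mean squared deviation `O(b)` from `s` in each coordinate
(`integral_sq_sub_mul_kernel_le`), hence mean absolute deviation `O(√b)`, and the Lipschitz property
of `f` gives `abs_smoothed_sub_le`.

Stochastic part. Multinomial-type weights with real exponents are at most one
(`Gamma_sum_mul_prod_rpow_le`), so on the simplex the kernel lies between `0` and `M = (1 / b + d) ^
d`. Hoeffding's inequality at a fixed `s` then gives the tail `2 exp (-2 n t² / M²)`. On the shrunk
simplex all kernel exponents are at least `1`, which makes the kernel Lipschitz in `s` with constant
`exp (O (1 / b))` (`abs_kernel_sub_le`). A net on which the kernel varies by at most `√b` therefore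
needs only `exp (O (1 / b))` points (`exists_net_card_le`). With `t` a multiple of `rate`, the
Hoeffding exponent beats both this cardinality and `2 log n` (`exp_mul_tail_le`), so the union bound
is summable and Borel–Cantelli applies. The crude Lipschitz constant costs only the factor `b ^ (-1
/ 2)` in the rate. Only events over finite nets are measured, never a supremum over an uncountable
set. -/

namespace DirichletKernel

open scoped NNReal

/-! ### Beta and Dirichlet integrals -/

section

theorem integral_rpow_mul_sub_rpow {a c t : ℝ} (ha : 0 ≤ a) (hc : 0 ≤ c) (ht : 0 ≤ t) :
    ∫ y in (0 : ℝ)..t, y ^ a * (t - y) ^ c =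
      t ^ (a + c + 1) * (Real.Gamma (a + 1) * Real.Gamma (c + 1) / Real.Gamma (a + c + 2)) := by
  rcases ht.eq_or_lt with rfl | ht
  · rw [intervalIntegral.integral_same, Real.zero_rpow (by linarith), zero_mul]
  have h := Complex.betaIntegral_scaled ((a + 1 : ℝ) : ℂ) ((c + 1 : ℝ) : ℂ) ht
  have hb := Complex.betaIntegral_eq_Gamma_mul_div ((a + 1 : ℝ) : ℂ) ((c + 1 : ℝ) : ℂ)
    (by simp; linarith) (by simp; linarith)
  rw [hb, Complex.Gamma_ofReal, Complex.Gamma_ofReal, ← Complex.ofReal_add,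
    Complex.Gamma_ofReal] at h
  have hl : ∫ y in (0 : ℝ)..t, (y : ℂ) ^ (((a + 1 : ℝ) : ℂ) - 1) *
      ((t : ℂ) - y) ^ (((c + 1 : ℝ) : ℂ) - 1) =
      ∫ y in (0 : ℝ)..t, ((y ^ a * (t - y) ^ c : ℝ) : ℂ) := by
    refine intervalIntegral.integral_congr fun y hy => ?_
    rw [Set.uIcc_of_le ht.le] at hy
    have h1 : ((a + 1 : ℝ) : ℂ) - 1 = (a : ℂ) := by push_cast; ring
    have h2 : ((c + 1 : ℝ) : ℂ) - 1 = (c : ℂ) := by push_cast; ring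
    simp only [h1, h2]
    rw [Complex.ofReal_mul, Complex.ofReal_cpow hy.1, Complex.ofReal_cpow (sub_nonneg.2 hy.2),
      Complex.ofReal_sub]
  rw [hl, intervalIntegral.integral_ofReal] at h
  have h3 : ((a + 1 + (c + 1) : ℝ) : ℂ) - 1 = ((a + c + 1 : ℝ) : ℂ) := by push_cast; ring
  rw [h3, ← Complex.ofReal_cpow ht.le] at h
  rw [show a + c + 2 = a + 1 + (c + 1) by ring]
  exact_mod_cast h

theorem intervalIntegrable_rpow_mul_sub_rpow {a c : ℝ} (ha : 0 ≤ a) (hc : 0 ≤ c) (t u v : ℝ) :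
    IntervalIntegrable (fun y : ℝ => y ^ a * (t - y) ^ c) volume u v :=
  ((Real.continuous_rpow_const ha).mul
    ((Real.continuous_rpow_const hc).comp (continuous_const.sub continuous_id))).intervalIntegrable
    _ _

/-- On `[0, x]` one has `x + y - u ≥ y` and `(u / x) ^ c ≤ 1`, so the integrand dominates `x ^ a * y
^ c * (u / x) ^ (a + c)`, which integrates exactly to the left side. -/
theorem le_integral_rpow_mul_sub_rpow {a c x y : ℝ} (ha : 0 ≤ a) (hc : 0 ≤ c) (hx : 0 ≤ x)
    (hy : 0 ≤ y) :
    x ^ a * y ^ c * (x / (a + c + 1)) ≤ ∫ u in (0 : ℝ)..x, u ^ a * (x + y - u) ^ c := by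
  rcases hx.eq_or_lt with rfl | hx
  · simp
  have h1 : ∫ u in (0 : ℝ)..x, x ^ a * y ^ c * (x ^ (-(a + c)) * u ^ (a + c)) =
      x ^ a * y ^ c * (x / (a + c + 1)) := by
    rw [intervalIntegral.integral_const_mul, intervalIntegral.integral_const_mul,
      integral_rpow (Or.inl (by linarith)), Real.zero_rpow (by linarith), sub_zero,
      Real.rpow_neg hx.le, Real.rpow_add_one hx.ne']
    have : x ^ (a + c) ≠ 0 := (Real.rpow_pos_of_pos hx _).ne'
    field_simp
  rw [← h1]
  refine intervalIntegral.integral_mono_on hx.le ?_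
    (intervalIntegrable_rpow_mul_sub_rpow ha hc _ _ _) fun u hu => ?_
  · exact ((Real.continuous_rpow_const (by linarith)).const_mul _).const_mul _
      |>.intervalIntegrable _ _
  · have h2 : (u / x) ^ c ≤ 1 :=
      Real.rpow_le_one (div_nonneg hu.1 hx.le) ((div_le_one hx).2 hu.2) hc
    have h3 : y ^ c ≤ (x + y - u) ^ c := Real.rpow_le_rpow hy (by linarith [hu.2]) hc
    have h4 : x ^ (-(a + c)) * u ^ (a + c) = (u / x) ^ a * (u / x) ^ c := by
      rw [← Real.rpow_add_of_nonneg (div_nonneg hu.1 hx.le) ha hc, Real.div_rpow hu.1 hx.le,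
        Real.rpow_neg hx.le, div_eq_inv_mul]
    have h5 : x ^ a * (u / x) ^ a = u ^ a := by
      rw [← Real.mul_rpow hx.le (div_nonneg hu.1 hx.le), mul_div_cancel₀ _ hx.ne']
    calc x ^ a * y ^ c * (x ^ (-(a + c)) * u ^ (a + c))
        = u ^ a * (y ^ c * (u / x) ^ c) := by rw [h4, ← h5]; ring
      _ ≤ u ^ a * ((x + y - u) ^ c * 1) := by
          have := Real.rpow_nonneg hu.1 a
          have := Real.rpow_nonneg (div_nonneg hu.1 hx.le) c
          have := Real.rpow_nonneg hy c
          have := this.trans h3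
          gcongr
      _ = _ := by rw [mul_one]

/-- A binomial probability with real parameters is at most one. The Beta integral over `[0, x + y]`
is split at `x`, and each half is bounded below by `le_integral_rpow_mul_sub_rpow`. The factors `x /
(a + c + 1)` and `y / (a + c + 1)` add up to what the Gamma recursion absorbs, so no constant is
lost. -/
theorem Gamma_add_mul_rpow_le {a c x y : ℝ} (ha : 0 ≤ a) (hc : 0 ≤ c) (hx : 0 ≤ x)
    (hy : 0 ≤ y) :
    Real.Gamma (a + c + 1) * (x ^ a * y ^ c) ≤
      (x + y) ^ (a + c) * (Real.Gamma (a + 1) * Real.Gamma (c + 1)) := by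
  have hG : 0 < Real.Gamma (a + c + 1) := Real.Gamma_pos_of_pos (by linarith)
  have hGa : 0 < Real.Gamma (a + 1) := Real.Gamma_pos_of_pos (by linarith)
  have hGc : 0 < Real.Gamma (c + 1) := Real.Gamma_pos_of_pos (by linarith)
  rcases (add_nonneg hx hy).eq_or_lt with h0 | ht
  · obtain rfl : x = 0 := by linarith
    obtain rfl : y = 0 := by linarith
    rcases ha.eq_or_lt with rfl | ha
    · simp [mul_comm]
    · rw [Real.zero_rpow ha.ne', zero_mul, mul_zero]
      positivity
  have h1 := integral_rpow_mul_sub_rpow ha hc ht.le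
  have h2 := le_integral_rpow_mul_sub_rpow ha hc hx hy
  have h3 := le_integral_rpow_mul_sub_rpow hc ha hy hx
  have h4 : ∫ u in (0 : ℝ)..y, u ^ c * (y + x - u) ^ a =
      ∫ u in x..(x + y), u ^ a * (x + y - u) ^ c := by
    have := intervalIntegral.integral_comp_sub_left
      (fun u : ℝ => u ^ a * (x + y - u) ^ c) (x + y) (a := 0) (b := y)
    simp only [sub_zero, add_sub_cancel_right] at this
    rw [← this]
    refine intervalIntegral.integral_congr fun u _ => ?_
    simp only [sub_sub_cancel]
    rw [add_comm y x, mul_comm]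
  have h5 := intervalIntegral.integral_add_adjacent_intervals
    (intervalIntegrable_rpow_mul_sub_rpow ha hc (x + y) 0 x)
    (intervalIntegrable_rpow_mul_sub_rpow ha hc (x + y) x (x + y))
  have h6 : Real.Gamma (a + c + 2) = (a + c + 1) * Real.Gamma (a + c + 1) := by
    rw [← Real.Gamma_add_one (by linarith)]; ring_nf
  rw [h6, Real.rpow_add_one ht.ne'] at h1
  rw [h4, add_comm c a] at h3
  have h7 : x ^ a * y ^ c * ((x + y) / (a + c + 1)) ≤
      (x + y) ^ (a + c) * (x + y) * (Real.Gamma (a + 1) * Real.Gamma (c + 1) /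
        ((a + c + 1) * Real.Gamma (a + c + 1))) := by
    rw [← h1, ← h5]
    calc _ = x ^ a * y ^ c * (x / (a + c + 1)) + y ^ c * x ^ a * (y / (a + c + 1)) := by ring
      _ ≤ _ := add_le_add h2 h3
  have hN : 0 < a + c + 1 := by linarith
  have h8 := mul_le_mul_of_nonneg_left h7
    (show 0 ≤ (a + c + 1) * Real.Gamma (a + c + 1) / (x + y) by positivity)
  calc _ = (a + c + 1) * Real.Gamma (a + c + 1) / (x + y) *
        (x ^ a * y ^ c * ((x + y) / (a + c + 1))) := by field_simp
    _ ≤ _ := h8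
    _ = _ := by field_simp

/-- The multinomial version, by merging one coordinate at a time with the total of the others. -/
theorem Gamma_sum_mul_prod_rpow_le {ι : Type*} (S : Finset ι) (k x : ι → ℝ)
    (hk : ∀ i ∈ S, 0 ≤ k i) (hx : ∀ i ∈ S, 0 ≤ x i) :
    Real.Gamma (∑ i ∈ S, k i + 1) * ∏ i ∈ S, x i ^ k i ≤
      (∑ i ∈ S, x i) ^ (∑ i ∈ S, k i) * ∏ i ∈ S, Real.Gamma (k i + 1) := by
  classical
  induction S using Finset.induction_on with
  | empty => simp
  | insert i S hi ih =>
    rw [Finset.forall_mem_insert] at hk hx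
    rw [Finset.sum_insert hi, Finset.sum_insert hi, Finset.prod_insert hi, Finset.prod_insert hi]
    have ih := ih hk.2 hx.2
    have hKS : 0 ≤ ∑ i ∈ S, k i := Finset.sum_nonneg hk.2
    have hXS : 0 ≤ ∑ i ∈ S, x i := Finset.sum_nonneg hx.2
    have hG : 0 < Real.Gamma (∑ i ∈ S, k i + 1) := Real.Gamma_pos_of_pos (by linarith)
    have hGi : 0 < Real.Gamma (k i + 1) := Real.Gamma_pos_of_pos (by linarith [hk.1])
    have hP : 0 ≤ ∏ i ∈ S, Real.Gamma (k i + 1) :=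
      Finset.prod_nonneg fun j hj => (Real.Gamma_pos_of_pos (by linarith [hk.2 j hj])).le
    have h := Gamma_add_mul_rpow_le hk.1 hKS hx.1 hXS
    have hxi := Real.rpow_nonneg hx.1 (k i)
    have hG2 : 0 < Real.Gamma (k i + ∑ i ∈ S, k i + 1) :=
      Real.Gamma_pos_of_pos (by linarith [hk.1])
    refine le_of_mul_le_mul_left ?_ hG
    calc Real.Gamma (∑ i ∈ S, k i + 1) *
          (Real.Gamma (k i + ∑ i ∈ S, k i + 1) * (x i ^ k i * ∏ i ∈ S, x i ^ k i))
        = Real.Gamma (k i + ∑ i ∈ S, k i + 1) * x i ^ k i *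
          (Real.Gamma (∑ i ∈ S, k i + 1) * ∏ i ∈ S, x i ^ k i) := by ring
      _ ≤ Real.Gamma (k i + ∑ i ∈ S, k i + 1) * x i ^ k i *
          ((∑ i ∈ S, x i) ^ (∑ i ∈ S, k i) * ∏ i ∈ S, Real.Gamma (k i + 1)) := by gcongr
      _ = (Real.Gamma (k i + ∑ i ∈ S, k i + 1) *
          (x i ^ k i * (∑ i ∈ S, x i) ^ (∑ i ∈ S, k i))) * ∏ i ∈ S, Real.Gamma (k i + 1) := by ring
      _ ≤ ((x i + ∑ i ∈ S, x i) ^ (k i + ∑ i ∈ S, k i) *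
          (Real.Gamma (k i + 1) * Real.Gamma (∑ i ∈ S, k i + 1))) *
          ∏ i ∈ S, Real.Gamma (k i + 1) := by gcongr
      _ = _ := by ring

theorem lintegral_Icc_rpow_mul_sub_rpow {a c t : ℝ} (ha : 0 ≤ a) (hc : 0 ≤ c) (ht : 0 ≤ t) :
    ∫⁻ y in Set.Icc 0 t, ENNReal.ofReal (y ^ a * (t - y) ^ c) = ENNReal.ofReal
      (t ^ (a + c + 1) * (Real.Gamma (a + 1) * Real.Gamma (c + 1) / Real.Gamma (a + c + 2))) := by
  rw [← integral_rpow_mul_sub_rpow ha hc ht, intervalIntegral.integral_of_le ht,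
    ← integral_Icc_eq_integral_Ioc, ofReal_integral_eq_lintegral_ofReal]
  · exact ((intervalIntegrable_iff_integrableOn_Icc_of_le ht).1
      (intervalIntegrable_rpow_mul_sub_rpow ha hc t 0 t))
  · filter_upwards [ae_restrict_mem measurableSet_Icc] with y hy
    exact mul_nonneg (Real.rpow_nonneg hy.1 _) (Real.rpow_nonneg (sub_nonneg.2 hy.2) _)

theorem measurableSet_nonneg_sum_le (d : ℕ) (t : ℝ) :
    MeasurableSet {x : Fin d → ℝ | (∀ i, 0 ≤ x i) ∧ ∑ i, x i ≤ t} := by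
  apply IsClosed.measurableSet
  refine IsClosed.inter (s₁ := {x : Fin d → ℝ | ∀ i, 0 ≤ x i}) ?_
    (isClosed_le (continuous_finsetSum _ fun i _ => continuous_apply i) continuous_const)
  rw [Set.ofPred_forall]
  exact isClosed_iInter fun i => isClosed_le continuous_const (continuous_apply i)

/-- The Dirichlet integral over the simplex of size `t`. -/
theorem lintegral_dirichlet (d : ℕ) : ∀ (k : Fin d → ℝ) (m t : ℝ), (∀ i, 0 ≤ k i) → 0 ≤ m →
    0 ≤ t →
    ∫⁻ x in {x : Fin d → ℝ | (∀ i, 0 ≤ x i) ∧ ∑ i, x i ≤ t},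
        ENNReal.ofReal ((t - ∑ i, x i) ^ m * ∏ i, x i ^ k i) =
      ENNReal.ofReal (t ^ (∑ i, k i + m + d) * (Real.Gamma (m + 1) * (∏ i, Real.Gamma (k i + 1)) /
        Real.Gamma (∑ i, k i + m + d + 1))) := by
  induction d with
  | zero =>
    intro k m t _ hm ht
    have hS : {x : Fin 0 → ℝ | (∀ i, 0 ≤ x i) ∧ ∑ i, x i ≤ t} = Set.univ := by
      ext x; simp [ht]
    have hG : Real.Gamma (m + 1) ≠ 0 := (Real.Gamma_pos_of_pos (by linarith)).ne'
    rw [hS, Measure.restrict_univ]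
    simp [lintegral_unique, hG, Measure.volume_pi_eq_dirac 0]
  | succ d ih =>
    intro k m t hk hm ht
    have hmp := (volume_preserving_piFinSuccAbove (fun _ : Fin (d + 1) => ℝ) 0).symm
    have hF : Measurable fun x : Fin (d + 1) → ℝ =>
        ENNReal.ofReal ((t - ∑ i, x i) ^ m * ∏ i, x i ^ k i) := by
      refine ENNReal.measurable_ofReal.comp (Measurable.mul ?_ ?_)
      · exact (measurable_const.sub (Finset.measurable_sum _
          fun i _ => measurable_pi_apply i)).pow_const _
      · exact Finset.measurable_prod _ fun i _ => (measurable_pi_apply i).pow_const _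
    rw [← lintegral_indicator (measurableSet_nonneg_sum_le _ t),
      ← hmp.lintegral_comp (hF.indicator (measurableSet_nonneg_sum_le _ t)),
      Measure.volume_eq_prod]
    have hprod := lintegral_prod (μ := (volume : Measure ℝ)) (ν := (volume : Measure (Fin d → ℝ)))
      _ ((hF.indicator (measurableSet_nonneg_sum_le _ t)).comp hmp.measurable).aemeasurable
    simp only [Function.comp_def] at hprod
    rw [hprod]
    set K : ℝ := ∑ i : Fin d, k i.succ with hK
    set G : ℝ := Real.Gamma (m + 1) * (∏ i : Fin d, Real.Gamma (k i.succ + 1)) /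
        Real.Gamma (K + m + d + 1) with hG
    have hK0 : 0 ≤ K := Finset.sum_nonneg fun i _ => hk _
    have hG0 : 0 ≤ G := by
      refine div_nonneg (mul_nonneg (Real.Gamma_pos_of_pos (by linarith)).le
        (Finset.prod_nonneg fun i _ => (Real.Gamma_pos_of_pos (by linarith [hk i.succ])).le))
        (Real.Gamma_pos_of_pos (by positivity)).le
    -- Fixing the first coordinate at `y` leaves a simplex of size `t - y`, which is why the
    -- induction quantifies over `t`. What remains is a Beta integral in `y`.
    have hcong : ∀ y : ℝ, ∫⁻ z : Fin d → ℝ,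
        ({x : Fin (d + 1) → ℝ | (∀ i, 0 ≤ x i) ∧ ∑ i, x i ≤ t}.indicator fun x =>
          ENNReal.ofReal ((t - ∑ i, x i) ^ m * ∏ i, x i ^ k i))
          ((MeasurableEquiv.piFinSuccAbove (fun _ : Fin (d + 1) => ℝ) 0).symm (y, z)) =
        (Set.Icc 0 t).indicator (fun y => ENNReal.ofReal (y ^ k 0 * (t - y) ^ (K + m + d)) *
          ENNReal.ofReal G) y := by
      intro y
      by_cases hy : y ∈ Set.Icc 0 t
      · rw [Set.indicator_of_mem hy, ENNReal.ofReal_mul (Real.rpow_nonneg hy.1 _), mul_assoc,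
          ← ENNReal.ofReal_mul (Real.rpow_nonneg (sub_nonneg.2 hy.2) _), hG,
          ← ih (fun i => k i.succ) m (t - y) (fun i => hk _) hm (sub_nonneg.2 hy.2),
          ← lintegral_const_mul' _ _ ENNReal.ofReal_ne_top,
          ← lintegral_indicator (measurableSet_nonneg_sum_le _ _)]
        refine lintegral_congr fun z => ?_
        simp only [MeasurableEquiv.piFinSuccAbove_symm_apply, Set.indicator_apply,
          Set.mem_ofPred_eq, Fin.forall_fin_succ, Fin.sum_univ_succ, Fin.prod_univ_succ,
          Fin.insertNthEquiv_zero, Fin.consEquiv_apply, Fin.cons_zero, Fin.cons_succ]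
        have : (((0 ≤ y) ∧ ∀ i, 0 ≤ z i) ∧ y + ∑ i, z i ≤ t) ↔
            ((∀ i, 0 ≤ z i) ∧ ∑ i, z i ≤ t - y) := by
          constructor
          · rintro ⟨⟨_, h⟩, h'⟩; exact ⟨h, by linarith⟩
          · rintro ⟨h, h'⟩; exact ⟨⟨hy.1, h⟩, by linarith⟩
        simp only [this]
        split_ifs with hz
        · rw [← ENNReal.ofReal_mul (Real.rpow_nonneg hy.1 _), sub_sub]
          congr 1; ring
        · rfl
      · rw [Set.indicator_of_notMem hy]
        refine (lintegral_congr fun z => ?_).trans lintegral_zero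
        refine Set.indicator_of_notMem (fun hmem => hy ?_) _
        simp only [MeasurableEquiv.piFinSuccAbove_symm_apply,
          Set.mem_ofPred_eq, Fin.forall_fin_succ, Fin.sum_univ_succ,
          Fin.insertNthEquiv_zero, Fin.consEquiv_apply, Fin.cons_zero, Fin.cons_succ] at hmem
        have : 0 ≤ ∑ i, z i := Finset.sum_nonneg fun i _ => hmem.1.2 i
        exact ⟨hmem.1.1, by linarith [hmem.2]⟩
    simp only [hcong]
    rw [lintegral_indicator measurableSet_Icc, lintegral_mul_const' _ _ ENNReal.ofReal_ne_top,
      lintegral_Icc_rpow_mul_sub_rpow (hk 0) (by positivity) ht, ← ENNReal.ofReal_mul' hG0]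
    congr 1
    rw [Fin.sum_univ_succ, Fin.prod_univ_succ, ← hK, hG]
    have h1 : Real.Gamma (K + m + d + 1) ≠ 0 := (Real.Gamma_pos_of_pos (by positivity)).ne'
    push_cast
    rw [show k 0 + (K + m + d) + 1 = k 0 + K + m + (d + 1) by ring,
      show k 0 + (K + m + d) + 2 = k 0 + K + m + (d + 1) + 1 by ring]
    field_simp

end

/-! ### Bounds and moments of the Dirichlet kernel -/

section

variable {d : ℕ}

theorem l1norm_eq_sum {x : Fin d → ℝ} (hx : x ∈ simplex d) : l1norm x = ∑ i, x i :=
  Finset.sum_congr rfl fun i _ => abs_of_nonneg (hx.1 i).1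

theorem simplex_eq (d : ℕ) :
    simplex d = {x : Fin d → ℝ | (∀ i, 0 ≤ x i) ∧ ∑ i, x i ≤ 1} := by
  ext x
  refine ⟨fun hx => ⟨fun i => (hx.1 i).1, l1norm_eq_sum hx ▸ hx.2⟩, fun hx => ?_⟩
  refine ⟨fun i => ⟨hx.1 i, ?_⟩, ?_⟩
  · exact (Finset.single_le_sum (fun j _ => hx.1 j) (Finset.mem_univ i)).trans hx.2
  · rw [l1norm, Finset.sum_congr rfl fun i _ => abs_of_nonneg (hx.1 i)]
    exact hx.2

theorem sum_le_one {x : Fin d → ℝ} (hx : x ∈ simplex d) : ∑ i, x i ≤ 1 :=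
  l1norm_eq_sum hx ▸ hx.2

/-- The normalizing constant of the Dirichlet kernel. -/
noncomputable def normalizer (b : ℝ) (s : Fin d → ℝ) : ℝ :=
  Real.Gamma (1 / b + d + 1) /
    (Real.Gamma ((1 - ∑ i, s i) / b + 1) * ∏ i, Real.Gamma (s i / b + 1))

/-- The unnormalized Dirichlet kernel. -/
noncomputable def rawKernel (b : ℝ) (s x : Fin d → ℝ) : ℝ :=
  (1 - ∑ i, x i) ^ ((1 - ∑ i, s i) / b) * ∏ i, x i ^ (s i / b)

section

variable {b : ℝ} {s x : Fin d → ℝ}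

theorem exponent_nonneg (hb : 0 < b) (hs : s ∈ simplex d) (i : Fin d) : 0 ≤ s i / b :=
  div_nonneg (hs.1 i).1 hb.le

theorem last_exponent_nonneg (hb : 0 < b) (hs : s ∈ simplex d) : 0 ≤ (1 - ∑ i, s i) / b :=
  div_nonneg (sub_nonneg.2 (sum_le_one hs)) hb.le

theorem sum_exponent (b : ℝ) (s : Fin d → ℝ) :
    ∑ i, s i / b + (1 - ∑ i, s i) / b = 1 / b := by
  rw [← Finset.sum_div]; ring

theorem kernel_eq (hb : 0 < b) (hs : s ∈ simplex d) (hx : x ∈ simplex d) :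
    kernel b s x = normalizer b s * rawKernel b s x := by
  have h1 : l1norm (fun i => s i / b + 1) + ((1 - l1norm s) / b + 1) = 1 / b + d + 1 := by
    have : l1norm (fun i => s i / b + 1) = ∑ i, s i / b + d := by
      rw [l1norm, Finset.sum_congr rfl fun i _ =>
        abs_of_nonneg (show 0 ≤ s i / b + 1 by linarith [exponent_nonneg hb hs i]),
        Finset.sum_add_distrib]
      simp
    rw [this, l1norm_eq_sum hs, ← sum_exponent b s]; ring
  rw [kernel, dirichletDensity, h1, l1norm_eq_sum hs, l1norm_eq_sum hx, normalizer, rawKernel]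
  simp only [add_sub_cancel_right]

theorem rawKernel_nonneg (hx : x ∈ simplex d) : 0 ≤ rawKernel b s x :=
  mul_nonneg (Real.rpow_nonneg (sub_nonneg.2 (sum_le_one hx)) _)
    (Finset.prod_nonneg fun i _ => Real.rpow_nonneg (hx.1 i).1 _)

theorem prod_Gamma_pos (hb : 0 < b) (hs : s ∈ simplex d) :
    0 < Real.Gamma ((1 - ∑ i, s i) / b + 1) * ∏ i, Real.Gamma (s i / b + 1) :=
  mul_pos (Real.Gamma_pos_of_pos (by linarith [last_exponent_nonneg hb hs]))
    (Finset.prod_pos fun i _ => Real.Gamma_pos_of_pos (by linarith [exponent_nonneg hb hs i]))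

theorem normalizer_pos (hb : 0 < b) (hs : s ∈ simplex d) : 0 < normalizer b s :=
  div_pos (Real.Gamma_pos_of_pos (by positivity)) (prod_Gamma_pos hb hs)

theorem kernel_nonneg (hb : 0 < b) (hs : s ∈ simplex d) (hx : x ∈ simplex d) :
    0 ≤ kernel b s x := by
  rw [kernel_eq hb hs hx]
  exact mul_nonneg (normalizer_pos hb hs).le (rawKernel_nonneg hx)

theorem Gamma_add_natCast_le (d : ℕ) {y : ℝ} (hy : 0 ≤ y) :
    Real.Gamma (y + d + 1) ≤ (y + d) ^ d * Real.Gamma (y + 1) := by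
  induction d with
  | zero => simp
  | succ d ih =>
    have hG := (Real.Gamma_pos_of_pos (by linarith : 0 < y + 1)).le
    push_cast
    rw [← add_assoc, Real.Gamma_add_one (by positivity)]
    have hpow : (y + d) ^ d ≤ (y + d + 1) ^ d :=
      pow_le_pow_left₀ (by positivity) (by linarith) d
    calc (y + d + 1) * Real.Gamma (y + d + 1)
        ≤ (y + d + 1) * ((y + d) ^ d * Real.Gamma (y + 1)) := by gcongr
      _ ≤ (y + d + 1) * ((y + d + 1) ^ d * Real.Gamma (y + 1)) := by
          gcongr
      _ = _ := by ring

/-- Any normalized Dirichlet weight is at most `(1 / b + d) ^ d`. -/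
theorem normalizer_mul_le (hb : 0 < b) (hs : s ∈ simplex d) {y : ℝ} (hx : ∀ i, 0 ≤ x i)
    (hy : 0 ≤ y) :
    normalizer b s * (y ^ ((1 - ∑ i, s i) / b) * ∏ i, x i ^ (s i / b)) ≤
      (1 / b + d) ^ d * (∑ i, x i + y) ^ (1 / b) := by
  -- The index `none` carries the last barycentric coordinate. Here `y` is free rather than `1 - ∑
  -- i, x i`, so that the bound also applies off the simplex, as in `normalizer_le`.
  have h := Gamma_sum_mul_prod_rpow_le (Finset.univ : Finset (Option (Fin d)))
    (fun o => o.elim ((1 - ∑ i, s i) / b) fun i => s i / b) (fun o => o.elim y x)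
    (by rintro (_ | i) -; exacts [last_exponent_nonneg hb hs, exponent_nonneg hb hs i])
    (by rintro (_ | i) -; exacts [hy, hx i])
  simp only [Fintype.sum_option, Fintype.prod_option, Option.elim] at h
  rw [add_comm _ (∑ i, s i / b), sum_exponent, add_comm y] at h
  have hg := Gamma_add_natCast_le d (one_div_pos.2 hb).le
  have hP : 0 ≤ y ^ ((1 - ∑ i, s i) / b) * ∏ i, x i ^ (s i / b) :=
    mul_nonneg (Real.rpow_nonneg hy _) (Finset.prod_nonneg fun i _ => Real.rpow_nonneg (hx i) _)
  rw [normalizer, div_mul_eq_mul_div, div_le_iff₀ (prod_Gamma_pos hb hs)]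
  calc _ ≤ (1 / b + d) ^ d * Real.Gamma (1 / b + 1) *
        (y ^ ((1 - ∑ i, s i) / b) * ∏ i, x i ^ (s i / b)) := by gcongr
    _ = (1 / b + d) ^ d * (Real.Gamma (1 / b + 1) *
        (y ^ ((1 - ∑ i, s i) / b) * ∏ i, x i ^ (s i / b))) := by ring
    _ ≤ (1 / b + d) ^ d * _ := mul_le_mul_of_nonneg_left h (by positivity)
    _ = _ := by ring

/-- The barycentric coordinates of `x` sum to one, so the power of the total mass disappears. This
is the range used in Hoeffding's inequality. -/
theorem kernel_le (hb : 0 < b) (hs : s ∈ simplex d) (hx : x ∈ simplex d) :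
    kernel b s x ≤ (1 / b + d) ^ d := by
  rw [kernel_eq hb hs hx, rawKernel]
  refine (normalizer_mul_le hb hs (fun i => (hx.1 i).1) (sub_nonneg.2 (sum_le_one hx))).trans ?_
  simp

/-- Setting all `d + 1` variables to `1` isolates the normalizer. The bound is exponential in `1 /
b`, but it enters only through the logarithm of a net's cardinality. -/
theorem normalizer_le (hb : 0 < b) (hs : s ∈ simplex d) :
    normalizer b s ≤ (1 / b + d) ^ d * (d + 1 : ℝ) ^ (1 / b) := by
  have h := normalizer_mul_le (x := fun _ => 1) hb hs (fun _ => zero_le_one) zero_le_one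
  simpa using h

theorem integrableOn_dirichlet {k : Fin d → ℝ} {m : ℝ} (hk : ∀ i, 0 ≤ k i) (hm : 0 ≤ m) :
    IntegrableOn (fun x => (1 - ∑ i, x i) ^ m * ∏ i, x i ^ k i) (simplex d) := by
  have hc : Continuous fun x : Fin d → ℝ => (1 - ∑ i, x i) ^ m * ∏ i, x i ^ k i :=
    ((Real.continuous_rpow_const hm).comp
      (continuous_const.sub (continuous_finsetSum _ fun i _ => continuous_apply i))).mul
    (continuous_finsetProd _ fun i _ =>
      (Real.continuous_rpow_const (hk i)).comp (continuous_apply i))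
  refine ⟨hc.aestronglyMeasurable, ?_⟩
  rw [hasFiniteIntegral_iff_ofReal, simplex_eq, lintegral_dirichlet d k m 1 hk hm zero_le_one]
  · exact ENNReal.ofReal_lt_top
  · filter_upwards [ae_restrict_mem measurableSet_simplex] with x hx
    exact mul_nonneg (Real.rpow_nonneg (sub_nonneg.2 (sum_le_one hx)) _)
      (Finset.prod_nonneg fun i _ => Real.rpow_nonneg (hx.1 i).1 _)

theorem integral_dirichlet {k : Fin d → ℝ} {m : ℝ} (hk : ∀ i, 0 ≤ k i) (hm : 0 ≤ m) :
    ∫ x in simplex d, (1 - ∑ i, x i) ^ m * ∏ i, x i ^ k i =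
      Real.Gamma (m + 1) * (∏ i, Real.Gamma (k i + 1)) / Real.Gamma (∑ i, k i + m + d + 1) := by
  have hK : 0 ≤ ∑ i, k i := Finset.sum_nonneg fun i _ => hk i
  rw [integral_eq_lintegral_of_nonneg_ae, simplex_eq, lintegral_dirichlet d k m 1 hk hm zero_le_one,
    Real.one_rpow, one_mul, ENNReal.toReal_ofReal]
  · exact div_nonneg (mul_nonneg (Real.Gamma_pos_of_pos (by linarith)).le
        (Finset.prod_nonneg fun i _ => (Real.Gamma_pos_of_pos (by linarith [hk i])).le))
        (Real.Gamma_pos_of_pos (by positivity)).le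
  · filter_upwards [ae_restrict_mem measurableSet_simplex] with x hx
    exact mul_nonneg (Real.rpow_nonneg (sub_nonneg.2 (sum_le_one hx)) _)
      (Finset.prod_nonneg fun i _ => Real.rpow_nonneg (hx.1 i).1 _)
  · exact (integrableOn_dirichlet hk hm).aestronglyMeasurable

/-- Keeps the moments within the Dirichlet family: the factor `x i ^ r` raises a single exponent by
`r`. -/
theorem pow_mul_rawKernel (hb : 0 < b) (hs : s ∈ simplex d) (hx : x ∈ simplex d) (i : Fin d)
    (r : ℕ) :
    x i ^ r * rawKernel b s x = (1 - ∑ i, x i) ^ ((1 - ∑ i, s i) / b) *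
      ∏ j, x j ^ (Function.update (fun j => s j / b) i (s i / b + r) j) := by
  rw [rawKernel, ← Finset.mul_prod_erase _ (fun j => x j ^ (s j / b)) (Finset.mem_univ i),
    ← Finset.mul_prod_erase _ (fun j => x j ^ (Function.update _ i _ j)) (Finset.mem_univ i),
    Function.update_self,
    Real.rpow_add_of_nonneg (hx.1 i).1 (exponent_nonneg hb hs i) (Nat.cast_nonneg r),
    Real.rpow_natCast]
  have : ∏ j ∈ Finset.univ.erase i,
      x j ^ (Function.update (fun j => s j / b) i (s i / b + r) j) =
      ∏ j ∈ Finset.univ.erase i, x j ^ (s j / b) :=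
    Finset.prod_congr rfl fun j hj => by rw [Function.update_of_ne (Finset.ne_of_mem_erase hj)]
  rw [this]; ring

theorem update_exponent_nonneg (hb : 0 < b) (hs : s ∈ simplex d) (i : Fin d) (r : ℕ)
    (j : Fin d) : 0 ≤ Function.update (fun j => s j / b) i (s i / b + r) j := by
  rcases eq_or_ne j i with rfl | h
  · rw [Function.update_self]
    linarith [exponent_nonneg hb hs j, (Nat.cast_nonneg r : (0 : ℝ) ≤ r)]
  · rw [Function.update_of_ne h]
    exact exponent_nonneg hb hs j

theorem integrableOn_pow_mul_kernel (hb : 0 < b) (hs : s ∈ simplex d) (i : Fin d) (r : ℕ) :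
    IntegrableOn (fun x => x i ^ r * kernel b s x) (simplex d) := by
  refine ((integrableOn_dirichlet (update_exponent_nonneg hb hs i r)
    (last_exponent_nonneg hb hs)).const_mul (normalizer b s)).congr ?_
  filter_upwards [ae_restrict_mem measurableSet_simplex] with x hx
  rw [kernel_eq hb hs hx, ← pow_mul_rawKernel hb hs hx]
  ring

theorem integral_pow_mul_kernel (hb : 0 < b) (hs : s ∈ simplex d) (i : Fin d) (r : ℕ) :
    ∫ x in simplex d, x i ^ r * kernel b s x =
      Real.Gamma (s i / b + r + 1) / Real.Gamma (s i / b + 1) *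
        (Real.Gamma (1 / b + d + 1) / Real.Gamma (1 / b + d + r + 1)) := by
  have h1 : ∫ x in simplex d, x i ^ r * kernel b s x =
      ∫ x in simplex d, normalizer b s * ((1 - ∑ i, x i) ^ ((1 - ∑ i, s i) / b) *
      ∏ j, x j ^ (Function.update (fun j => s j / b) i (s i / b + r) j)) := by
    refine setIntegral_congr_fun measurableSet_simplex fun x hx => ?_
    rw [kernel_eq hb hs hx, ← pow_mul_rawKernel hb hs hx]
    ring
  rw [h1, integral_const_mul, integral_dirichlet (update_exponent_nonneg hb hs i r)
    (last_exponent_nonneg hb hs), normalizer, ← Finset.mul_prod_erase _ (fun j =>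
      Real.Gamma (Function.update (fun j => s j / b) i (s i / b + r) j + 1)) (Finset.mem_univ i),
    Function.update_self,
    ← Finset.mul_prod_erase _ (fun j => Real.Gamma (s j / b + 1)) (Finset.mem_univ i)]
  have h2 : ∏ j ∈ Finset.univ.erase i,
      Real.Gamma (Function.update (fun j => s j / b) i (s i / b + r) j + 1) =
      ∏ j ∈ Finset.univ.erase i, Real.Gamma (s j / b + 1) :=
    Finset.prod_congr rfl fun j hj => by rw [Function.update_of_ne (Finset.ne_of_mem_erase hj)]
  have h3 : ∑ j, Function.update (fun j => s j / b) i (s i / b + r) j + (1 - ∑ i, s i) / b =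
      1 / b + r := by
    rw [Finset.sum_update_of_mem (Finset.mem_univ i), ← sum_exponent b s,
      ← Finset.add_sum_erase _ (fun j => s j / b) (Finset.mem_univ i),
      Finset.sdiff_singleton_eq_erase]
    ring
  rw [h2, h3, show 1 / b + (r : ℝ) + d + 1 = 1 / b + d + r + 1 by ring]
  have hE : ∏ j ∈ Finset.univ.erase i, Real.Gamma (s j / b + 1) ≠ 0 :=
    (Finset.prod_pos fun j _ =>
      Real.Gamma_pos_of_pos (by linarith [exponent_nonneg hb hs j])).ne'
  have hG1 : Real.Gamma ((1 - ∑ i, s i) / b + 1) ≠ 0 :=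
    (Real.Gamma_pos_of_pos (by linarith [last_exponent_nonneg hb hs])).ne'
  generalize ∏ j ∈ Finset.univ.erase i, Real.Gamma (s j / b + 1) = E at *
  generalize Real.Gamma ((1 - ∑ i, s i) / b + 1) = g at *
  generalize Real.Gamma (s i / b + 1) = g'
  generalize Real.Gamma (s i / b + r + 1) = g''
  field_simp

theorem integral_kernel (hd : 1 ≤ d) (hb : 0 < b) (hs : s ∈ simplex d) :
    ∫ x in simplex d, kernel b s x = 1 := by
  have h := integral_pow_mul_kernel hb hs ⟨0, hd⟩ 0
  have h1 := (Real.Gamma_pos_of_pos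
    (by linarith [exponent_nonneg hb hs ⟨0, hd⟩] : 0 < s ⟨0, hd⟩ / b + 1)).ne'
  have h2 := (Real.Gamma_pos_of_pos (by positivity : 0 < 1 / b + d + 1)).ne'
  simpa [h1, h2, -one_div] using h

/-- Expanding the square and inserting the moments of order `0`, `1`, `2`, the terms of order zero
in `b` cancel. The numerator left is `b (sᵢ - sᵢ²)` plus `b²` times a bounded factor, over a
denominator at least `1`. These contribute `1` and `2 + (d + 1) (d + 2)` to the constant. -/
theorem integral_sq_sub_mul_kernel_le (hd : 1 ≤ d) (hb : 0 < b) (hb1 : b ≤ 1)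
    (hs : s ∈ simplex d) (i : Fin d) :
    ∫ x in simplex d, (x i - s i) ^ 2 * kernel b s x ≤ (3 + (d + 1) * (d + 2)) * b := by
  have i0 := integrableOn_pow_mul_kernel hb hs i 0
  have i1 := integrableOn_pow_mul_kernel hb hs i 1
  have i2 := integrableOn_pow_mul_kernel hb hs i 2
  have e0 := integral_kernel hd hb hs
  have e1 := integral_pow_mul_kernel hb hs i 1
  have e2 := integral_pow_mul_kernel hb hs i 2
  have hsi := hs.1 i
  have ha := exponent_nonneg hb hs i
  have hA : 0 < 1 / b + d + 1 := by positivity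
  have g1 : 0 < Real.Gamma (s i / b + 1) := Real.Gamma_pos_of_pos (by linarith)
  have g2 : 0 < Real.Gamma (1 / b + d + 1) := Real.Gamma_pos_of_pos hA
  have g3 : Real.Gamma (s i / b + (1 : ℕ) + 1) = (s i / b + 1) * Real.Gamma (s i / b + 1) := by
    rw [Nat.cast_one, Real.Gamma_add_one (by positivity)]
  have g4 : Real.Gamma (s i / b + (2 : ℕ) + 1) =
      (s i / b + 2) * ((s i / b + 1) * Real.Gamma (s i / b + 1)) := by
    rw [Nat.cast_two, Real.Gamma_add_one (by positivity),
      ← Real.Gamma_add_one (s := s i / b + 1) (by positivity)]; ring_nf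
  have g5 : Real.Gamma (1 / b + d + (1 : ℕ) + 1) =
      (1 / b + d + 1) * Real.Gamma (1 / b + d + 1) := by
    rw [Nat.cast_one, Real.Gamma_add_one (by positivity)]
  have g6 : Real.Gamma (1 / b + d + (2 : ℕ) + 1) =
      (1 / b + d + 2) * ((1 / b + d + 1) * Real.Gamma (1 / b + d + 1)) := by
    rw [Nat.cast_two, Real.Gamma_add_one (by positivity),
      ← Real.Gamma_add_one (s := 1 / b + d + 1) (by positivity)]; ring_nf
  rw [g3, g5] at e1
  rw [g4, g6] at e2
  have hexp : ∫ x in simplex d, (x i - s i) ^ 2 * kernel b s x =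
      (∫ x in simplex d, x i ^ 2 * kernel b s x) -
        2 * s i * (∫ x in simplex d, x i ^ 1 * kernel b s x) +
        s i ^ 2 * ∫ x in simplex d, x i ^ 0 * kernel b s x := by
    have h1 := integral_sub i2 (i1.const_mul (2 * s i))
    have h2 := integral_add (i2.sub (i1.const_mul (2 * s i))) (i0.const_mul (s i ^ 2))
    simp only [Pi.sub_apply] at h2
    rw [h1, integral_const_mul, integral_const_mul] at h2
    rw [← h2]
    refine integral_congr_ae (Eventually.of_forall fun x => ?_)
    simp only
    ring
  rw [hexp, e1, e2]
  simp only [pow_zero, one_mul, e0]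
  have hP : 1 ≤ (1 + b * (d + 1)) * (1 + b * (d + 2)) := by
    have : 0 ≤ b * (d + 1 : ℝ) := by positivity
    have : 0 ≤ b * (d + 2 : ℝ) := by positivity
    nlinarith
  have hval : (s i / b + 2) * ((s i / b + 1) * Real.Gamma (s i / b + 1)) /
        Real.Gamma (s i / b + 1) * (Real.Gamma (1 / b + d + 1) /
        ((1 / b + d + 2) * ((1 / b + d + 1) * Real.Gamma (1 / b + d + 1)))) -
      2 * s i * ((s i / b + 1) * Real.Gamma (s i / b + 1) / Real.Gamma (s i / b + 1) *
        (Real.Gamma (1 / b + d + 1) / ((1 / b + d + 1) * Real.Gamma (1 / b + d + 1)))) +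
      s i ^ 2 * 1 =
      (b * (s i - s i ^ 2) + b ^ 2 * (2 - 2 * s i * (d + 2) + s i ^ 2 * ((d + 1) * (d + 2)))) /
        ((1 + b * (d + 1)) * (1 + b * (d + 2))) := by
    have q1 : (s i / b + 2) * ((s i / b + 1) * Real.Gamma (s i / b + 1)) /
        Real.Gamma (s i / b + 1) = (s i + 2 * b) * (s i + b) / b ^ 2 := by
      rw [← mul_assoc, mul_div_assoc, div_self g1.ne']; field_simp
    have q2 : (s i / b + 1) * Real.Gamma (s i / b + 1) / Real.Gamma (s i / b + 1) =
        (s i + b) / b := by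
      rw [mul_div_assoc, div_self g1.ne']; field_simp
    have q3 : Real.Gamma (1 / b + d + 1) /
        ((1 / b + d + 2) * ((1 / b + d + 1) * Real.Gamma (1 / b + d + 1))) =
        b ^ 2 / ((1 + b * (d + 1)) * (1 + b * (d + 2))) := by
      have : 1 / b + d + 1 = (1 + b * (d + 1)) / b := by field_simp; ring
      have h2 : 1 / b + d + 2 = (1 + b * (d + 2)) / b := by field_simp; ring
      generalize Real.Gamma (1 / b + d + 1) = g at *
      rw [this, h2]; field_simp
    have q4 : Real.Gamma (1 / b + d + 1) / ((1 / b + d + 1) * Real.Gamma (1 / b + d + 1)) =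
        b / (1 + b * (d + 1)) := by
      have : 1 / b + d + 1 = (1 + b * (d + 1)) / b := by field_simp; ring
      generalize Real.Gamma (1 / b + d + 1) = g at *
      rw [this]; field_simp
    rw [q1, q2, q3, q4]
    field_simp
    ring
  rw [hval, div_le_iff₀ (by linarith)]
  have hD : (0 : ℝ) ≤ (d + 1) * (d + 2) := by positivity
  have h1 : s i - s i ^ 2 ≤ 1 := by nlinarith [hsi.1, hsi.2]
  have h2 : 2 - 2 * s i * (d + 2) + s i ^ 2 * ((d + 1) * (d + 2)) ≤
      2 + ((d + 1) * (d + 2) : ℝ) := by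
    have : s i ^ 2 ≤ 1 := pow_le_one₀ hsi.1 hsi.2
    have : s i ^ 2 * ((d + 1) * (d + 2)) ≤ 1 * ((d + 1) * (d + 2) : ℝ) := by gcongr
    have : 0 ≤ 2 * s i * (d + 2 : ℝ) := by have := hsi.1; positivity
    linarith
  calc b * (s i - s i ^ 2) + b ^ 2 * (2 - 2 * s i * (d + 2) + s i ^ 2 * ((d + 1) * (d + 2)))
      ≤ b * 1 + b ^ 2 * (2 + (d + 1) * (d + 2)) := by gcongr
    _ ≤ b * 1 + b * (2 + (d + 1) * (d + 2)) := by
        have : b ^ 2 ≤ b := by nlinarith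
        gcongr
    _ = (3 + (d + 1) * (d + 2)) * b * 1 := by ring
    _ ≤ _ := by gcongr

end

end

/-! ### The bias -/

section

variable {d : ℕ} {f : (Fin d → ℝ) → ℝ} {b : ℝ} {s x : Fin d → ℝ}

/-- Continuity on the simplex supplies the measurability of `f` that `IsDensity` does not include.
-/
theorem smoothed_eq_setIntegral (hfc : ContinuousOn f (simplex d))
    (hf : IsDensity f) (b : ℝ) (s : Fin d → ℝ) :
    smoothed f b s = ∫ x in simplex d, f x * kernel b s x := by
  have hm : AEMeasurable (fun x => ENNReal.ofReal (f x)) (volume.restrict (simplex d)) :=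
    (hfc.aemeasurable measurableSet_simplex).ennreal_ofReal
  rw [smoothed, law, integral_withDensity_eq_integral_toReal_smul₀ hm
    (Eventually.of_forall fun _ => ENNReal.ofReal_lt_top)]
  refine setIntegral_congr_fun measurableSet_simplex fun x hx => ?_
  simp only [smul_eq_mul]
  rw [ENNReal.toReal_ofReal (hf.nonneg x hx)]

theorem integrableOn_kernel (hd : 1 ≤ d) (hb : 0 < b) (hs : s ∈ simplex d) :
    IntegrableOn (kernel b s) (simplex d) := by
  simpa using integrableOn_pow_mul_kernel hb hs ⟨0, hd⟩ 0

theorem abs_sub_le_of_lipschitz {L : ℝ≥0} (hL : LipschitzOnWith L f (simplex d))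
    (hx : x ∈ simplex d) (hs : s ∈ simplex d) : |f x - f s| ≤ L * ∑ i, |x i - s i| := by
  have h := hL.dist_le_mul x hx s hs
  rw [Real.dist_eq] at h
  refine h.trans (mul_le_mul_of_nonneg_left ?_ L.2)
  refine (dist_pi_le_iff (Finset.sum_nonneg fun i _ => abs_nonneg _)).2 fun i => ?_
  rw [Real.dist_eq]
  exact Finset.single_le_sum (f := fun i => |x i - s i|) (fun j _ => abs_nonneg _)
    (Finset.mem_univ i)

/-- A pointwise substitute for Cauchy–Schwarz. With `r = √b` it turns a second moment of order `b`
into a first moment of order `√b`. -/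
theorem abs_le_sq_div_add {r : ℝ} (hr : 0 < r) (u : ℝ) : |u| ≤ u ^ 2 / (2 * r) + r / 2 := by
  have h : u ^ 2 / (2 * r) + r / 2 - |u| = (|u| - r) ^ 2 / (2 * r) := by
    rw [sub_sq, sq_abs]; field_simp; ring
  have : 0 ≤ (|u| - r) ^ 2 / (2 * r) := by positivity
  linarith

theorem integrableOn_sq_sub_mul_kernel (hb : 0 < b) (hs : s ∈ simplex d) (i : Fin d) :
    IntegrableOn (fun x => (x i - s i) ^ 2 * kernel b s x) (simplex d) := by
  refine (((integrableOn_pow_mul_kernel hb hs i 2).sub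
    ((integrableOn_pow_mul_kernel hb hs i 1).const_mul (2 * s i))).add
    ((integrableOn_pow_mul_kernel hb hs i 0).const_mul (s i ^ 2))).congr
    (Eventually.of_forall fun x => ?_)
  simp only [Pi.add_apply, Pi.sub_apply]
  ring

theorem abs_smoothed_sub_le (hd : 1 ≤ d) {L : ℝ≥0} (hL : LipschitzOnWith L f (simplex d))
    (hf : IsDensity f) (hb : 0 < b) (hb1 : b ≤ 1) (hs : s ∈ simplex d) :
    |smoothed f b s - f s| ≤ L * (d * ((3 + (d + 1) * (d + 2)) / 2 + 1 / 2)) * √b := by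
  have hr : 0 < √b := Real.sqrt_pos.2 hb
  have iK := integrableOn_kernel hd hb hs
  have iQ := integrableOn_sq_sub_mul_kernel hb hs
  have iT : ∀ i, IntegrableOn (fun x => 1 / (2 * √b) * ((x i - s i) ^ 2 * kernel b s x) +
      √b / 2 * kernel b s x) (simplex d) := fun i =>
    ((iQ i).const_mul (1 / (2 * √b))).add (iK.const_mul (√b / 2))
  have iG : IntegrableOn (fun x => (L : ℝ) * ∑ i, (1 / (2 * √b) *
      ((x i - s i) ^ 2 * kernel b s x) + √b / 2 * kernel b s x)) (simplex d) :=
    (integrable_finsetSum _ fun i _ => iT i).const_mul (L : ℝ)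
  have hbound : ∀ x ∈ simplex d, ‖(f x - f s) * kernel b s x‖ ≤
      L * ∑ i, (1 / (2 * √b) * ((x i - s i) ^ 2 * kernel b s x) + √b / 2 * kernel b s x) := by
    intro x hx
    have hK := kernel_nonneg hb hs hx
    rw [Real.norm_eq_abs, abs_mul, abs_of_nonneg hK]
    calc |f x - f s| * kernel b s x ≤ (L * ∑ i, |x i - s i|) * kernel b s x := by
          gcongr; exact abs_sub_le_of_lipschitz hL hx hs
      _ ≤ (L * ∑ i, ((x i - s i) ^ 2 / (2 * √b) + √b / 2)) * kernel b s x := by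
          gcongr with i; exact abs_le_sq_div_add hr _
      _ = _ := by
          rw [mul_assoc, Finset.sum_mul]
          congr 1
          exact Finset.sum_congr rfl fun i _ => by ring
  have hmem : ∀ᵐ x ∂(volume.restrict (simplex d)), x ∈ simplex d :=
    ae_restrict_mem measurableSet_simplex
  have hfm : AEStronglyMeasurable f (volume.restrict (simplex d)) :=
    (hL.continuousOn.aemeasurable measurableSet_simplex).aestronglyMeasurable
  have iD : IntegrableOn (fun x => (f x - f s) * kernel b s x) (simplex d) :=
    iG.mono' ((hfm.sub aestronglyMeasurable_const).mul iK.aestronglyMeasurable)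
      (hmem.mono hbound)
  have hdiff : smoothed f b s - f s = ∫ x in simplex d, (f x - f s) * kernel b s x := by
    have h := integral_add iD (iK.const_mul (f s))
    rw [integral_const_mul, integral_kernel hd hb hs, mul_one] at h
    rw [smoothed_eq_setIntegral hL.continuousOn hf, sub_eq_iff_eq_add, ← h]
    exact integral_congr_ae (Eventually.of_forall fun x => by simp only; ring)
  rw [hdiff, ← Real.norm_eq_abs]
  refine (norm_integral_le_of_norm_le iG (hmem.mono hbound)).trans ?_
  rw [integral_const_mul, integral_finsetSum _ fun i _ => iT i, mul_assoc (L : ℝ)]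
  refine mul_le_mul_of_nonneg_left ?_ L.2
  have hi : ∀ i, ∫ x in simplex d, (1 / (2 * √b) * ((x i - s i) ^ 2 * kernel b s x) +
      √b / 2 * kernel b s x) ≤ ((3 + (d + 1) * (d + 2)) / 2 + 1 / 2) * √b := by
    intro i
    rw [integral_add ((iQ i).const_mul _) (iK.const_mul _), integral_const_mul,
      integral_const_mul, integral_kernel hd hb hs]
    calc _ ≤ 1 / (2 * √b) * ((3 + (d + 1) * (d + 2)) * b) + √b / 2 * 1 := by
          gcongr; exact integral_sq_sub_mul_kernel_le hd hb hb1 hs i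
      _ = 1 / (2 * √b) * ((3 + (d + 1) * (d + 2)) * (√b * √b)) + √b / 2 * 1 := by
          rw [Real.mul_self_sqrt hb.le]
      _ = _ := by field_simp
  refine (Finset.sum_le_sum fun i _ => hi i).trans (le_of_eq ?_)
  simp [mul_assoc]

end

/-! ### Lipschitz dependence of the kernel on its location -/

section

variable {d : ℕ}

/-- The derivative in the exponent is `x ^ p * log x`, bounded by `x * |log x| ≤ 1` once `p ≥ 1`.
For exponents near `0` this fails as `x → 0`, which is why the estimate is confined to the shrunk
simplex. -/
theorem abs_rpow_sub_rpow_le {x p q : ℝ} (hx : 0 ≤ x) (hx1 : x ≤ 1) (hp : 1 ≤ p) (hq : 1 ≤ q) :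
    |x ^ p - x ^ q| ≤ |p - q| := by
  wlog h : p ≤ q generalizing p q
  · rw [abs_sub_comm, abs_sub_comm p]
    exact this hq hp (le_of_not_ge h)
  rcases hx.eq_or_lt with rfl | hx
  · rw [Real.zero_rpow (by linarith), Real.zero_rpow (by linarith), sub_self, abs_zero]
    exact abs_nonneg _
  have h1 : x ^ q ≤ x ^ p := Real.rpow_le_rpow_of_exponent_ge hx hx1 h
  rw [abs_of_nonneg (sub_nonneg.2 h1), abs_sub_comm, abs_of_nonneg (sub_nonneg.2 h)]
  have h2 : x ^ q = x ^ p * x ^ (q - p) := by rw [← Real.rpow_add hx]; ring_nf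
  have h3 : 1 + Real.log x * (q - p) ≤ x ^ (q - p) := by
    rw [Real.rpow_def_of_pos hx]
    linarith [Real.add_one_le_exp (Real.log x * (q - p))]
  have h4 : x ^ p ≤ x := by
    simpa using Real.rpow_le_rpow_of_exponent_ge hx hx1 hp
  have h5 : x * -Real.log x ≤ 1 := by
    have := Real.one_sub_inv_le_log_of_pos hx
    have h : x * (1 - x⁻¹) ≤ x * Real.log x := by gcongr
    rw [mul_sub, mul_inv_cancel₀ hx.ne'] at h
    linarith
  have hl : 0 ≤ -Real.log x := by linarith [Real.log_nonpos hx.le hx1]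
  have hqp : 0 ≤ q - p := sub_nonneg.2 h
  have hxp := Real.rpow_nonneg hx.le p
  calc x ^ p - x ^ q = x ^ p * (1 - x ^ (q - p)) := by rw [h2]; ring
    _ ≤ x ^ p * (-Real.log x * (q - p)) := by gcongr; linarith
    _ ≤ x * (-Real.log x * (q - p)) := by gcongr
    _ = (x * -Real.log x) * (q - p) := by ring
    _ ≤ 1 * (q - p) := by gcongr
    _ = q - p := one_mul _

/-- By convexity of `log Γ`, the slope on `[p, q]` lies between those on `[p - 1, p]` and `[q, q +
1]`, which the functional equation evaluates as `log (p - 1) ≥ 0` and `log q`. -/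
theorem abs_log_Gamma_sub_le {p q P : ℝ} (hp : 2 ≤ p) (hq : 2 ≤ q) (hpP : p ≤ P) (hqP : q ≤ P) :
    |Real.log (Real.Gamma p) - Real.log (Real.Gamma q)| ≤ |p - q| * Real.log P := by
  wlog h : p ≤ q generalizing p q
  · rw [abs_sub_comm, abs_sub_comm p]
    exact this hq hp hqP hpP (le_of_not_ge h)
  rcases h.eq_or_lt with rfl | h
  · simp
  have hc := Real.convexOn_log_Gamma
  have hG : ∀ y : ℝ, 0 < y → Real.log (Real.Gamma (y + 1)) =
      Real.log y + Real.log (Real.Gamma y) := fun y hy => by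
    rw [Real.Gamma_add_one hy.ne', Real.log_mul hy.ne' (Real.Gamma_pos_of_pos hy).ne']
  have h1 := hc.slope_mono_adjacent (x := p) (y := q) (z := q + 1)
    (Set.mem_Ioi.2 (by linarith)) (Set.mem_Ioi.2 (by linarith)) h (by linarith)
  have h2 := hc.slope_mono_adjacent (x := p - 1) (y := p) (z := q)
    (Set.mem_Ioi.2 (by linarith)) (Set.mem_Ioi.2 (by linarith)) (by linarith) h
  simp only [Function.comp_apply] at h1 h2
  have g1 := hG q (by linarith)
  have g2 := hG (p - 1) (by linarith)
  rw [sub_add_cancel] at g2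
  rw [g1, add_sub_cancel_right, add_sub_cancel_left, div_one, div_le_iff₀ (by linarith)] at h1
  rw [g2, add_sub_cancel_right, sub_sub_cancel, div_one, le_div_iff₀ (by linarith)] at h2
  have h3 : 0 ≤ Real.log (p - 1) := Real.log_nonneg (by linarith)
  have h4 : Real.log q ≤ Real.log P := Real.log_le_log (by linarith) hqP
  have h5 : 0 ≤ Real.log (p - 1) * (q - p) := mul_nonneg h3 (by linarith)
  have h6 : Real.log q * (q - p) ≤ Real.log P * (q - p) :=
    mul_le_mul_of_nonneg_right h4 (by linarith)
  rw [abs_sub_comm, abs_sub_comm p, abs_of_nonneg (by linarith : 0 ≤ q - p), abs_le]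
  rw [← g2] at h2
  constructor <;> linarith

theorem abs_prod_sub_prod_le {ι : Type*} (S : Finset ι) (u v : ι → ℝ)
    (hu : ∀ i ∈ S, |u i| ≤ 1) (hv : ∀ i ∈ S, |v i| ≤ 1) :
    |∏ i ∈ S, u i - ∏ i ∈ S, v i| ≤ ∑ i ∈ S, |u i - v i| := by
  classical
  induction S using Finset.induction_on with
  | empty => simp
  | insert i S hi ih =>
    rw [Finset.forall_mem_insert] at hu hv
    rw [Finset.prod_insert hi, Finset.prod_insert hi, Finset.sum_insert hi]
    have hU : |∏ i ∈ S, u i| ≤ 1 := by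
      rw [Finset.abs_prod]; exact Finset.prod_le_one (fun _ _ => abs_nonneg _) hu.2
    calc |u i * ∏ i ∈ S, u i - v i * ∏ i ∈ S, v i|
        = |(u i - v i) * ∏ i ∈ S, u i + v i * (∏ i ∈ S, u i - ∏ i ∈ S, v i)| := by ring_nf
      _ ≤ |u i - v i| * |∏ i ∈ S, u i| + |v i| * |∏ i ∈ S, u i - ∏ i ∈ S, v i| := by
          rw [← abs_mul, ← abs_mul]; exact abs_add_le _ _
      _ ≤ |u i - v i| * 1 + 1 * ∑ i ∈ S, |u i - v i| := by
          gcongr; exacts [hv.1, ih hu.2 hv.2]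
      _ = _ := by ring

theorem abs_exp_sub_exp_le {u v c : ℝ} (hu : Real.exp u ≤ c) (hv : Real.exp v ≤ c) :
    |Real.exp u - Real.exp v| ≤ c * |u - v| := by
  wlog h : v ≤ u generalizing u v
  · rw [abs_sub_comm, abs_sub_comm u]
    exact this hv hu (le_of_not_ge h)
  rw [abs_of_nonneg (sub_nonneg.2 (Real.exp_le_exp.2 h)), abs_of_nonneg (sub_nonneg.2 h)]
  have h1 : Real.exp v = Real.exp u * Real.exp (v - u) := by rw [← Real.exp_add]; ring_nf
  have h2 := Real.add_one_le_exp (v - u)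
  have h3 := Real.exp_pos u
  calc Real.exp u - Real.exp v = Real.exp u * (1 - Real.exp (v - u)) := by rw [h1]; ring
    _ ≤ Real.exp u * (u - v) := mul_le_mul_of_nonneg_left (by linarith) h3.le
    _ ≤ c * (u - v) := mul_le_mul_of_nonneg_right hu (by linarith)

variable {b η : ℝ} {s s' x : Fin d → ℝ}

theorem abs_exponent_sub_le (hb : 0 < b) (h : ∀ i, |s i - s' i| ≤ η) (i : Fin d) :
    |s i / b - s' i / b| ≤ η / b := by
  rw [← sub_div, abs_div, abs_of_pos hb]
  gcongr
  exact h i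

theorem abs_last_exponent_sub_le (hb : 0 < b) (h : ∀ i, |s i - s' i| ≤ η) :
    |(1 - ∑ i, s i) / b - (1 - ∑ i, s' i) / b| ≤ d * (η / b) := by
  rw [← sub_div, abs_div, abs_of_pos hb, ← mul_div_assoc]
  gcongr
  rw [show (1 - ∑ i, s i) - (1 - ∑ i, s' i) = ∑ i, (s' i - s i) by
    rw [Finset.sum_sub_distrib]; ring]
  refine (Finset.abs_sum_le_sum_abs _ _).trans ?_
  refine (Finset.sum_le_sum fun i _ => (abs_sub_comm (s' i) (s i)).trans_le (h i)).trans ?_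
  simp

theorem abs_rawKernel_sub_le (hb : 0 < b) (hx : x ∈ simplex d)
    (hs : (∀ i, 1 ≤ s i / b) ∧ 1 ≤ (1 - ∑ i, s i) / b)
    (hs' : (∀ i, 1 ≤ s' i / b) ∧ 1 ≤ (1 - ∑ i, s' i) / b) (h : ∀ i, |s i - s' i| ≤ η) :
    |rawKernel b s x - rawKernel b s' x| ≤ 2 * d * (η / b) := by
  have hy0 : 0 ≤ 1 - ∑ i, x i := sub_nonneg.2 (sum_le_one hx)
  have hy1 : 1 - ∑ i, x i ≤ 1 := by linarith [Finset.sum_nonneg fun i (_ : i ∈ Finset.univ) =>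
    (hx.1 i).1]
  have hle : ∀ y k : ℝ, 0 ≤ y → y ≤ 1 → 1 ≤ k → |y ^ k| ≤ 1 := fun y k h0 h1 hk => by
    rw [abs_of_nonneg (Real.rpow_nonneg h0 _)]
    exact Real.rpow_le_one h0 h1 (by linarith)
  have hp := abs_prod_sub_prod_le (Finset.univ : Finset (Option (Fin d)))
    (fun o => o.elim ((1 - ∑ i, x i) ^ ((1 - ∑ i, s i) / b)) fun i => x i ^ (s i / b))
    (fun o => o.elim ((1 - ∑ i, x i) ^ ((1 - ∑ i, s' i) / b)) fun i => x i ^ (s' i / b))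
    (by rintro (_ | i) -; exacts [hle _ _ hy0 hy1 hs.2, hle _ _ (hx.1 i).1 (hx.1 i).2 (hs.1 i)])
    (by rintro (_ | i) -; exacts [hle _ _ hy0 hy1 hs'.2, hle _ _ (hx.1 i).1 (hx.1 i).2 (hs'.1 i)])
  simp only [Fintype.sum_option, Fintype.prod_option, Option.elim] at hp
  refine hp.trans ?_
  have h1 := (abs_rpow_sub_rpow_le hy0 hy1 hs.2 hs'.2).trans (abs_last_exponent_sub_le hb h)
  have h2 : ∑ i, |x i ^ (s i / b) - x i ^ (s' i / b)| ≤ ∑ _i : Fin d, η / b :=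
    Finset.sum_le_sum fun i _ => (abs_rpow_sub_rpow_le (hx.1 i).1 (hx.1 i).2 (hs.1 i)
      (hs'.1 i)).trans (abs_exponent_sub_le hb h i)
  simp only [Finset.sum_const, Finset.card_univ, Fintype.card_fin, nsmul_eq_mul] at h2
  linarith

theorem log_normalizer (hb : 0 < b) (hs : s ∈ simplex d) :
    Real.log (normalizer b s) = Real.log (Real.Gamma (1 / b + d + 1)) -
      (Real.log (Real.Gamma ((1 - ∑ i, s i) / b + 1)) +
        ∑ i, Real.log (Real.Gamma (s i / b + 1))) := by
  have h1 := (Real.Gamma_pos_of_pos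
    (by linarith [last_exponent_nonneg hb hs] : 0 < (1 - ∑ i, s i) / b + 1)).ne'
  have h2 : ∀ i ∈ Finset.univ, Real.Gamma (s i / b + 1) ≠ 0 := fun i _ =>
    (Real.Gamma_pos_of_pos (by linarith [exponent_nonneg hb hs i])).ne'
  rw [normalizer, Real.log_div (Real.Gamma_pos_of_pos (by positivity)).ne'
    (prod_Gamma_pos hb hs).ne', Real.log_mul h1 (Finset.prod_ne_zero_iff.2 h2),
    Real.log_prod h2]

/-- The numerator does not depend on the location and cancels. Each remaining Gamma term has
logarithmic slope at most `log (1 / b + 1) ≤ 1 / b`. -/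
theorem abs_log_normalizer_sub_le (hb : 0 < b) (hss : s ∈ simplex d) (hss' : s' ∈ simplex d)
    (hs : (∀ i, 1 ≤ s i / b) ∧ 1 ≤ (1 - ∑ i, s i) / b)
    (hs' : (∀ i, 1 ≤ s' i / b) ∧ 1 ≤ (1 - ∑ i, s' i) / b) (h : ∀ i, |s i - s' i| ≤ η) :
    |Real.log (normalizer b s) - Real.log (normalizer b s')| ≤ 2 * d * (η / b) * (1 / b) := by
  have hP : Real.log (1 / b + 1) ≤ 1 / b := by
    have := Real.log_le_sub_one_of_pos (by positivity : 0 < 1 / b + 1)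
    linarith
  have key : ∀ {p q : ℝ}, 1 ≤ p → 1 ≤ q → p ≤ 1 / b → q ≤ 1 / b →
      |Real.log (Real.Gamma (p + 1)) - Real.log (Real.Gamma (q + 1))| ≤ |p - q| * (1 / b) := by
    intro p q hp hq hpb hqb
    have h1 := abs_log_Gamma_sub_le (p := p + 1) (q := q + 1) (P := 1 / b + 1)
      (by linarith) (by linarith) (by linarith) (by linarith)
    rw [add_sub_add_right_eq_sub] at h1
    exact h1.trans (mul_le_mul_of_nonneg_left hP (abs_nonneg _))
  have hle : ∀ {t : Fin d → ℝ}, t ∈ simplex d → ∀ i, t i / b ≤ 1 / b := fun ht i => by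
    have := (ht.1 i).2
    gcongr
  have hle' : ∀ {t : Fin d → ℝ}, t ∈ simplex d → (1 - ∑ i, t i) / b ≤ 1 / b := fun {t} ht => by
    have : 0 ≤ ∑ i, t i := Finset.sum_nonneg fun i _ => (ht.1 i).1
    gcongr
    linarith
  rw [log_normalizer hb hss, log_normalizer hb hss']
  have hb' : 0 ≤ 1 / b := by positivity
  have h1 := (key hs.2 hs'.2 (hle' hss) (hle' hss')).trans
    (mul_le_mul_of_nonneg_right (abs_last_exponent_sub_le hb h) hb')
  have h2 : ∑ i, |Real.log (Real.Gamma (s i / b + 1)) - Real.log (Real.Gamma (s' i / b + 1))| ≤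
      ∑ _i : Fin d, η / b * (1 / b) := Finset.sum_le_sum fun i _ =>
    (key (hs.1 i) (hs'.1 i) (hle hss i) (hle hss' i)).trans
      (mul_le_mul_of_nonneg_right (abs_exponent_sub_le hb h i) hb')
  simp only [Finset.sum_const, Finset.card_univ, Fintype.card_fin, nsmul_eq_mul] at h2
  have h3 := Finset.abs_sum_le_sum_abs (fun i => Real.log (Real.Gamma (s i / b + 1)) -
    Real.log (Real.Gamma (s' i / b + 1))) Finset.univ
  rw [Finset.sum_sub_distrib] at h3
  have h4 := abs_le.1 h1
  have h5 := abs_le.1 (h3.trans h2)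
  rw [abs_le]
  constructor <;> linarith [h4.1, h4.2, h5.1, h5.2]

/-- A Lipschitz constant for the Dirichlet kernel as a function of its location. -/
noncomputable def kernelLip (d : ℕ) (b : ℝ) : ℝ :=
  4 * d * ((1 / b + d) ^ d * (d + 1 : ℝ) ^ (1 / b)) * (1 / b) ^ 2

theorem exponents_of_mem_shrunkSimplex (hd : 1 ≤ d) (hb : 0 < b)
    (hs : s ∈ shrunkSimplex d (b * d)) :
    (∀ i, 1 ≤ s i / b) ∧ 1 ≤ (1 - ∑ i, s i) / b := by
  have h1 : b ≤ b * d := le_mul_of_one_le_right hb.le (by exact_mod_cast hd)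
  refine ⟨fun i => (one_le_div hb).2 (h1.trans (hs.2.2 i)), (one_le_div hb).2 (h1.trans ?_)⟩
  rw [← l1norm_eq_sum hs.1]
  exact hs.2.1

theorem abs_kernel_sub_le (hd : 1 ≤ d) (hb : 0 < b) (hb1 : b ≤ 1)
    (hs : s ∈ shrunkSimplex d (b * d)) (hs' : s' ∈ shrunkSimplex d (b * d))
    (h : ∀ i, |s i - s' i| ≤ η) (hx : x ∈ simplex d) :
    |kernel b s x - kernel b s' x| ≤ kernelLip d b * η := by
  have hη : 0 ≤ η := (abs_nonneg _).trans (h ⟨0, hd⟩)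
  have he := exponents_of_mem_shrunkSimplex hd hb hs
  have he' := exponents_of_mem_shrunkSimplex hd hb hs'
  have hn := normalizer_le hb hs.1
  have hn' := normalizer_le hb hs'.1
  have hp := normalizer_pos hb hs.1
  have hp' := normalizer_pos hb hs'.1
  rw [kernelLip]
  set G : ℝ := (1 / b + d) ^ d * (d + 1 : ℝ) ^ (1 / b) with hG
  have hG0 : 0 ≤ G := hp.le.trans hn
  have h1 : |normalizer b s - normalizer b s'| ≤ G * (2 * d * (η / b) * (1 / b)) := by
    have := abs_exp_sub_exp_le (u := Real.log (normalizer b s))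
      (v := Real.log (normalizer b s')) (c := G) (by rwa [Real.exp_log hp])
      (by rwa [Real.exp_log hp'])
    rw [Real.exp_log hp, Real.exp_log hp'] at this
    exact this.trans (mul_le_mul_of_nonneg_left
      (abs_log_normalizer_sub_le hb hs.1 hs'.1 he he' h) hG0)
  have h2 := abs_rawKernel_sub_le hb hx he he' h
  have h3 : |rawKernel b s x| ≤ 1 := by
    rw [abs_of_nonneg (rawKernel_nonneg hx)]
    refine mul_le_one₀ (Real.rpow_le_one (sub_nonneg.2 (sum_le_one hx)) ?_ (by linarith [he.2]))
      (Finset.prod_nonneg fun i _ => Real.rpow_nonneg (hx.1 i).1 _)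
      (Finset.prod_le_one (fun i _ => Real.rpow_nonneg (hx.1 i).1 _) fun i _ =>
        Real.rpow_le_one (hx.1 i).1 (hx.1 i).2 (by linarith [he.1 i]))
    linarith [Finset.sum_nonneg fun i (_ : i ∈ Finset.univ) => (hx.1 i).1]
  have hb' : 1 ≤ 1 / b := (one_le_div hb).2 hb1
  rw [kernel_eq hb hs.1 hx, kernel_eq hb hs'.1 hx]
  calc |normalizer b s * rawKernel b s x - normalizer b s' * rawKernel b s' x|
      = |(normalizer b s - normalizer b s') * rawKernel b s x +
          normalizer b s' * (rawKernel b s x - rawKernel b s' x)| := by ring_nf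
    _ ≤ |normalizer b s - normalizer b s'| * |rawKernel b s x| +
          |normalizer b s'| * |rawKernel b s x - rawKernel b s' x| := by
        rw [← abs_mul, ← abs_mul]; exact abs_add_le _ _
    _ ≤ G * (2 * d * (η / b) * (1 / b)) * 1 + G * (2 * d * (η / b)) := by
        rw [abs_of_pos hp']; gcongr
    -- Since `b ≤ 1`, an extra factor `1 / b` makes both terms alike, whence `4 * d` and `(1 / b) ^
    -- 2` in `kernelLip`.
    _ ≤ G * (2 * d * (η / b) * (1 / b)) * 1 + G * (2 * d * (η / b)) * (1 / b) := by
        have : 0 ≤ G * (2 * d * (η / b)) := by positivity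
        linarith [le_mul_of_one_le_right this hb']
    _ = _ := by field_simp; ring

end

/-! ### Concentration of the estimator -/

section

variable {d : ℕ}

/-- A subset of the simplex has an inner net of mesh `1 / N` with at most `(N + 1) ^ d` points. -/
theorem exists_finset_net {A : Set (Fin d → ℝ)} (hA : A ⊆ simplex d) {N : ℕ} (hN : 0 < N) :
    ∃ F : Finset (Fin d → ℝ), (F : Set (Fin d → ℝ)) ⊆ A ∧ F.card ≤ (N + 1) ^ d ∧
      ∀ s ∈ A, ∃ s' ∈ F, ∀ i, |s i - s' i| ≤ 1 / N := by
  classical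
  have hN' : (0 : ℝ) < N := by exact_mod_cast hN
  let cell : (Fin d → ℝ) → (Fin d → Fin (N + 1)) := fun s i => Fin.ofNat (N + 1) ⌊N * s i⌋₊
  have hcell : ∀ s ∈ A, ∀ i, (cell s i : ℕ) = ⌊N * s i⌋₊ := fun s hs i => by
    have h := (hA hs).1 i
    have : ⌊N * s i⌋₊ ≤ N := Nat.floor_le_of_le (mul_le_of_le_one_right hN'.le h.2)
    simp only [cell, Fin.val_ofNat]
    exact Nat.mod_eq_of_lt (by omega)
  -- Representatives are taken in `A` rather than at grid points, because the Lipschitz bound needs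
  -- both locations in the shrunk simplex.
  let rep : (Fin d → Fin (N + 1)) → (Fin d → ℝ) := fun v =>
    if h : ∃ s ∈ A, cell s = v then h.choose else 0
  have hrep : ∀ s ∈ A, rep (cell s) ∈ A ∧ cell (rep (cell s)) = cell s := fun s hs => by
    have h : ∃ t ∈ A, cell t = cell s := ⟨s, hs, rfl⟩
    simp only [rep, dif_pos h]
    exact h.choose_spec
  refine ⟨(Finset.univ.filter fun v => ∃ s ∈ A, cell s = v).image rep, ?_, ?_, ?_⟩
  · intro t ht
    obtain ⟨v, hv, rfl⟩ := Finset.mem_image.1 (Finset.mem_coe.1 ht)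
    obtain ⟨s, hs, rfl⟩ := (Finset.mem_filter.1 hv).2
    exact (hrep s hs).1
  · refine Finset.card_image_le.trans ((Finset.card_filter_le _ _).trans ?_)
    simp
  · intro s hs
    refine ⟨rep (cell s), Finset.mem_image_of_mem _
      (Finset.mem_filter.2 ⟨Finset.mem_univ _, s, hs, rfl⟩), fun i => ?_⟩
    obtain ⟨h1, h2⟩ := hrep s hs
    have h3 : ⌊N * rep (cell s) i⌋₊ = ⌊N * s i⌋₊ := by
      rw [← hcell _ h1, ← hcell _ hs, h2]
    have p1 := ((hA hs).1 i).1
    have p2 := ((hA h1).1 i).1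
    have e1 := Nat.floor_le (mul_nonneg hN'.le p1)
    have e2 := Nat.lt_floor_add_one (N * s i)
    have e3 := Nat.floor_le (mul_nonneg hN'.le p2)
    have e4 := Nat.lt_floor_add_one (N * rep (cell s) i)
    rw [h3] at e3 e4
    rw [le_div_iff₀ hN', ← abs_of_pos hN', ← abs_mul, abs_le]
    constructor <;> nlinarith

theorem abs_estimator_sub_le {Ω : Type u} {b : ℝ} {s s' : Fin d → ℝ}
    {x : ℕ → Ω → Fin d → ℝ} {ω : Ω} {n : ℕ}
    (hn : 1 ≤ n) {c : ℝ} (h : ∀ i, |kernel b s (x i ω) - kernel b s' (x i ω)| ≤ c) :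
    |estimator x n b ω s - estimator x n b ω s'| ≤ c := by
  have hn0 : (0 : ℝ) < n := by exact_mod_cast hn
  rw [estimator, estimator, ← mul_sub, ← Finset.sum_sub_distrib, abs_mul,
    abs_of_pos (one_div_pos.2 hn0), one_div_mul_eq_div, div_le_iff₀ hn0]
  refine (Finset.abs_sum_le_sum_abs _ _).trans ((Finset.sum_le_sum fun i _ => h i).trans ?_)
  simp [mul_comm]

section

variable {f : (Fin d → ℝ) → ℝ} {b : ℝ} {s : Fin d → ℝ} {Ω : Type u} [MeasurableSpace Ω]
  {P : Measure Ω} {X : ℕ → Ω → Fin d → ℝ}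

theorem ae_law_mem_simplex (f : (Fin d → ℝ) → ℝ) : ∀ᵐ x ∂(law f), x ∈ simplex d :=
  (withDensity_absolutelyContinuous _ _).ae_le (ae_restrict_mem measurableSet_simplex)

theorem IsSample.ae_mem_simplex (hX : IsSample P f X) (i : ℕ) : ∀ᵐ ω ∂P, X i ω ∈ simplex d := by
  have h := ae_law_mem_simplex f
  rw [← hX.map_eq i] at h
  exact ae_of_ae_map (hX.measurable i).aemeasurable h

theorem IsSample.integral_kernel_eq (hX : IsSample P f X) (b : ℝ) (s : Fin d → ℝ) (i : ℕ) :
    ∫ ω, kernel b s (X i ω) ∂P = smoothed f b s := by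
  rw [smoothed, ← hX.map_eq i, integral_map (hX.measurable i).aemeasurable
    (measurable_kernel b s).aestronglyMeasurable]

/-- Hoeffding's inequality for the Dirichlet kernel estimator at a point. -/
theorem measureReal_abs_estimator_sub_ge_le [IsProbabilityMeasure P] (hX : IsSample P f X)
    (hb : 0 < b) (hs : s ∈ simplex d) {n : ℕ} (hn : 1 ≤ n) {t : ℝ} (ht : 0 ≤ t) :
    P.real {ω | t ≤ |estimator X n b ω s - smoothed f b s|} ≤
      2 * Real.exp (-(2 * n * t ^ 2 / ((1 / b + d) ^ d) ^ 2)) := by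
  set M : ℝ := (1 / b + d) ^ d with hM
  have hM0 : 0 < M := by positivity
  have hn0 : (0 : ℝ) < n := by exact_mod_cast hn
  set Y : ℕ → Ω → ℝ := fun i ω => kernel b s (X i ω) - smoothed f b s with hY
  -- Hoeffding's lemma: a variable with values in `[0, M]` is, once centred, sub-Gaussian with
  -- parameter `(M / 2) ^ 2`.
  set c : ℝ≥0 := (‖M - 0‖₊ / 2) ^ 2 with hc
  have hcM : (c : ℝ) = M ^ 2 / 4 := by
    rw [hc]; push_cast; rw [sub_zero, Real.norm_of_nonneg hM0.le]; ring
  have hsub : ∀ i, HasSubgaussianMGF (Y i) c P := fun i => by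
    have h := hasSubgaussianMGF_of_mem_Icc (μ := P) (X := fun ω => kernel b s (X i ω))
      (a := 0) (b := M) ((measurable_kernel b s).comp (hX.measurable i)).aemeasurable
      ((hX.ae_mem_simplex i).mono fun ω hω => ⟨kernel_nonneg hb hs hω, kernel_le hb hs hω⟩)
    rwa [hX.integral_kernel_eq] at h
  have hind : iIndepFun Y P := hX.indep.comp (fun _ x => kernel b s x - smoothed f b s)
    fun _ => (measurable_kernel b s).sub_const _
  have hind' : iIndepFun (fun i => -Y i) P := hind.comp (fun _ x => -x) fun _ => measurable_neg
  have hsum : ∀ ω, ∑ i ∈ Finset.range n, Y i ω = n * (estimator X n b ω s - smoothed f b s) := by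
    intro ω
    rw [hY, estimator]
    simp only [Finset.sum_sub_distrib, Finset.sum_const, Finset.card_range, nsmul_eq_mul]
    field_simp
  have hexp : -(n * t) ^ 2 / (2 * n * (c : ℝ)) = -(2 * n * t ^ 2 / M ^ 2) := by
    rw [hcM]; field_simp; ring
  have h1 := HasSubgaussianMGF.measure_sum_range_ge_le_of_iIndepFun hind
    (n := n) (fun i _ => hsub i) (mul_nonneg hn0.le ht)
  have h2 := HasSubgaussianMGF.measure_sum_range_ge_le_of_iIndepFun hind'
    (n := n) (fun i _ => (hsub i).neg) (mul_nonneg hn0.le ht)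
  rw [hexp] at h1 h2
  calc P.real {ω | t ≤ |estimator X n b ω s - smoothed f b s|}
      ≤ P.real ({ω | n * t ≤ ∑ i ∈ Finset.range n, Y i ω} ∪
          {ω | n * t ≤ ∑ i ∈ Finset.range n, (-Y i) ω}) := by
        refine measureReal_mono fun ω hω => ?_
        simp only [Pi.neg_apply, Finset.sum_neg_distrib, hsum, Set.mem_union, Set.mem_ofPred_eq,
          ← mul_neg]
        rcases le_abs.1 (Set.mem_ofPred_eq ▸ hω : t ≤ |_|) with h | h
        · exact Or.inl (mul_le_mul_of_nonneg_left h hn0.le)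
        · exact Or.inr (mul_le_mul_of_nonneg_left h hn0.le)
    _ ≤ _ := (measureReal_union_le _ _).trans (add_le_add h1 h2)
    _ = _ := by ring

theorem measureReal_exists_abs_estimator_sub_ge_le [IsProbabilityMeasure P]
    (hX : IsSample P f X) (hb : 0 < b) {F : Finset (Fin d → ℝ)} (hF : ↑F ⊆ simplex d) {n : ℕ}
    (hn : 1 ≤ n) {t : ℝ} (ht : 0 ≤ t) :
    P.real {ω | ∃ s ∈ F, t ≤ |estimator X n b ω s - smoothed f b s|} ≤
      F.card * (2 * Real.exp (-(2 * n * t ^ 2 / ((1 / b + d) ^ d) ^ 2))) := by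
  have : {ω | ∃ s ∈ F, t ≤ |estimator X n b ω s - smoothed f b s|} =
      ⋃ s ∈ F, {ω | t ≤ |estimator X n b ω s - smoothed f b s|} := by
    ext ω; simp
  rw [this]
  refine (measureReal_biUnion_finset_le _ _).trans ((Finset.sum_le_sum fun s hs =>
    measureReal_abs_estimator_sub_ge_le hX hb (hF hs) hn ht).trans ?_)
  simp

/-- Borel–Cantelli for a bound valid only from some index on, obtained by shifting the sequence. -/
theorem ae_eventually_notMem_of_eventually_le [IsFiniteMeasure P] {A : ℕ → Set Ω} {g : ℕ → ℝ}
    (hg : Summable g) (h : ∀ᶠ n in atTop, P.real (A n) ≤ g n) :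
    ∀ᵐ ω ∂P, ∀ᶠ n in atTop, ω ∉ A n := by
  obtain ⟨n₀, hn₀⟩ := eventually_atTop.1 h
  have hs : (∑' n, P (A (n + n₀))) ≠ ∞ := by
    refine ne_top_of_le_ne_top ((summable_nat_add_iff n₀).2 hg).tsum_ofReal_ne_top
      (ENNReal.tsum_le_tsum fun n => ?_)
    rw [← ofReal_measureReal]
    exact ENNReal.ofReal_le_ofReal (hn₀ _ (Nat.le_add_left _ _))
  filter_upwards [ae_eventually_notMem hs] with ω hω
  obtain ⟨m, hm⟩ := eventually_atTop.1 hω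
  refine eventually_atTop.2 ⟨m + n₀, fun n hn => ?_⟩
  have := hm (n - n₀) (by omega)
  rwa [Nat.sub_add_cancel (by omega)] at this

theorem abs_smoothed_sub_smoothed_le (hf : IsDensity f) {s' : Fin d → ℝ} (hb : 0 < b)
    (hs : s ∈ simplex d) (hs' : s' ∈ simplex d) {c : ℝ}
    (h : ∀ x ∈ simplex d, |kernel b s x - kernel b s' x| ≤ c) :
    |smoothed f b s - smoothed f b s'| ≤ c := by
  have := hf.isProbabilityMeasure
  rw [smoothed, smoothed, ← integral_sub (integrable_kernel hf hb hs) (integrable_kernel hf hb hs')]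
  refine (norm_integral_le_of_norm_le_const (C := c)
    (f := fun x => kernel b s x - kernel b s' x) ((ae_law_mem_simplex f).mono h)).trans ?_
  simp

end

/-- The net used at bandwidth `b` has `exp (O (1 / b))` points. -/
theorem exists_net_card_le (d : ℕ) : ∃ c : ℝ, 0 ≤ c ∧ ∀ b : ℝ, 0 < b → b ≤ 1 →
    ((⌈kernelLip d b / √b⌉₊ + 1 + 1 : ℕ) : ℝ) ^ d ≤ Real.exp (c / b) := by
  -- The summands are the exponents `e1` to `e4` of the four factors. The cube of `1 / b` comes from
  -- `(1 / b) ^ 2` in `kernelLip` and from `1 / √b ≤ 1 / b`.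
  set a : ℝ := 4 * d + d * (d + 1) + d + 3 with ha
  have ha0 : 0 ≤ a := by positivity
  refine ⟨d * (a + 3), by positivity, fun b hb hb1 => ?_⟩
  have hy : 1 ≤ 1 / b := (one_le_div hb).2 hb1
  have hsq : b ≤ √b := Real.le_sqrt_of_sq_le (by nlinarith)
  have hle : ∀ z : ℝ, z ≤ Real.exp z := fun z => by linarith [Real.add_one_le_exp z]
  have hK : kernelLip d b / √b ≤ Real.exp (a * (1 / b)) := by
    have h0 : 0 ≤ kernelLip d b := by unfold kernelLip; positivity
    have h1 : kernelLip d b / √b ≤ kernelLip d b * (1 / b) := by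
      rw [mul_one_div]; gcongr
    refine h1.trans ?_
    rw [kernelLip]
    generalize 1 / b = y at *
    have hy0 : 0 ≤ y := by linarith
    have e1 : (4 * d : ℝ) ≤ Real.exp (4 * d * y) :=
      (le_mul_of_one_le_right (by positivity) hy).trans (hle _)
    have e2 : (y + d) ^ d ≤ Real.exp (d * (d + 1) * y) := by
      have : y + d ≤ Real.exp ((d + 1) * y) := by
        refine le_trans ?_ (hle _)
        nlinarith [mul_le_mul_of_nonneg_left hy (Nat.cast_nonneg (α := ℝ) d)]
      calc _ ≤ Real.exp ((d + 1) * y) ^ d := by gcongr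
        _ = _ := by rw [← Real.exp_nat_mul]; ring_nf
    have e3 : (d + 1 : ℝ) ^ y ≤ Real.exp (d * y) := by
      rw [Real.rpow_def_of_pos (by positivity)]
      refine Real.exp_le_exp.2 (mul_le_mul_of_nonneg_right ?_ hy0)
      linarith [Real.log_le_sub_one_of_pos (by positivity : (0 : ℝ) < d + 1)]
    have e4 : y ^ 3 ≤ Real.exp (3 * y) := by
      calc y ^ 3 ≤ Real.exp y ^ 3 := by gcongr; exact hle y
        _ = _ := by rw [← Real.exp_nat_mul]; norm_num
    calc 4 * d * ((y + d) ^ d * (d + 1 : ℝ) ^ y) * y ^ 2 * y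
        = 4 * d * ((y + d) ^ d * (d + 1 : ℝ) ^ y) * y ^ 3 := by ring
      _ ≤ Real.exp (4 * d * y) * (Real.exp (d * (d + 1) * y) * Real.exp (d * y)) *
          Real.exp (3 * y) := by gcongr
      _ = _ := by rw [← Real.exp_add, ← Real.exp_add, ← Real.exp_add, ha]; ring_nf
  have hN : ((⌈kernelLip d b / √b⌉₊ + 1 + 1 : ℕ) : ℝ) ≤ Real.exp ((a + 3) * (1 / b)) := by
    have h0 : 0 ≤ kernelLip d b / √b := by unfold kernelLip; positivity
    have h1 := Nat.ceil_lt_add_one h0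
    have h2 : 1 ≤ Real.exp (a * (1 / b)) := Real.one_le_exp (by positivity)
    have h3 : 4 ≤ Real.exp (3 * (1 / b)) := by
      have := Real.add_one_le_exp (3 * (1 / b))
      linarith
    rw [add_mul, Real.exp_add]
    push_cast
    nlinarith
  calc _ ≤ Real.exp ((a + 3) * (1 / b)) ^ d := by gcongr
    _ = _ := by rw [← Real.exp_nat_mul]; ring_nf

/-- The stochastic rate of the Dirichlet kernel estimator. -/
noncomputable def rate (d n : ℕ) (b : ℝ) : ℝ :=
  |Real.log b| * (Real.log n) ^ (3 / 2 : ℝ) / (b ^ ((d : ℝ) + 1 / 2) * √(n : ℝ))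

theorem rate_nonneg (d n : ℕ) {b : ℝ} (hb : 0 < b) : 0 ≤ rate d n b :=
  div_nonneg (mul_nonneg (abs_nonneg _) (Real.rpow_nonneg (Real.log_natCast_nonneg n) _))
    (mul_nonneg (Real.rpow_nonneg hb.le _) (Real.sqrt_nonneg _))

theorem rate_sq (d n : ℕ) {b : ℝ} (hb : 0 < b) :
    rate d n b ^ 2 = |Real.log b| ^ 2 * (Real.log n) ^ 3 / (b ^ (2 * d + 1) * n) := by
  have h1 : ((Real.log n) ^ (3 / 2 : ℝ)) ^ 2 = (Real.log n) ^ 3 := by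
    rw [← Real.rpow_natCast, ← Real.rpow_mul (Real.log_natCast_nonneg n)]
    norm_num
  have h2 : (b ^ ((d : ℝ) + 1 / 2)) ^ 2 = b ^ (2 * d + 1) := by
    rw [← Real.rpow_natCast, ← Real.rpow_mul hb.le, ← Real.rpow_natCast]
    push_cast
    ring_nf
  rw [rate, div_pow, mul_pow, mul_pow, h1, h2, Real.sq_sqrt (Nat.cast_nonneg n)]

/-- Here the rate is calibrated. The factor `(1 + d) ^ d` offsets `M ≤ ((1 + d) / b) ^ d`; the
surplus `1 / b` in `rate ^ 2` pays for the net, and the powers of `log n` leave a further `2 * log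
n`, so the total is of order `1 / n²`. -/
theorem exp_mul_tail_le {d n : ℕ} {b c : ℝ} (hb : 0 < b) (hlog : 1 ≤ |Real.log b|) (hb1 : b ≤ 1)
    (hn : 1 ≤ n) (hlogn : 1 ≤ Real.log n) (hc : 0 ≤ c) :
    Real.exp (c / b) * (2 * Real.exp (-(2 * n * ((1 + d) ^ d * (c + 1) * rate d n b) ^ 2 /
      ((1 / b + d) ^ d) ^ 2))) ≤ 2 * (1 / (n : ℝ) ^ 2) := by
  have hn0 : (0 : ℝ) < n := by exact_mod_cast hn
  have hM : (1 / b + d) ^ d ≤ ((1 + d) * (1 / b)) ^ d := by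
    have h : 1 ≤ 1 / b := (one_le_div hb).2 hb1
    have : (d : ℝ) ≤ d * (1 / b) := le_mul_of_one_le_right (Nat.cast_nonneg d) h
    refine pow_le_pow_left₀ (by positivity) (by linarith) d
  have key : c / b + 2 * Real.log n ≤ 2 * n * ((1 + d) ^ d * (c + 1) * rate d n b) ^ 2 /
      ((1 / b + d) ^ d) ^ 2 := by
    have h1 : 2 * n * ((1 + d) ^ d * (c + 1) * rate d n b) ^ 2 =
        (((1 + d) * (1 / b)) ^ d) ^ 2 *
          (2 * (c + 1) ^ 2 * (|Real.log b| ^ 2 * (Real.log n) ^ 3) / b) := by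
      rw [mul_pow _ (rate d n b), rate_sq d n hb, mul_pow (1 + (d : ℝ)) (1 / b) d,
        div_pow, one_pow]
      field_simp
      ring
    have h2 : Real.log n ≤ |Real.log b| ^ 2 * (Real.log n) ^ 3 := by
      have h3 : 1 ≤ |Real.log b| ^ 2 := one_le_pow₀ hlog
      have h4 : Real.log n ≤ Real.log n ^ 3 := le_self_pow₀ hlogn (by norm_num)
      exact h4.trans (le_mul_of_one_le_left (by positivity) h3)
    have h5 : c / b + 2 * Real.log n ≤
        2 * (c + 1) ^ 2 * (|Real.log b| ^ 2 * (Real.log n) ^ 3) / b := by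
      rw [div_add' _ _ _ hb.ne']
      gcongr
      have h6 : 2 * (c + 1) * Real.log n ≤ 2 * (c + 1) ^ 2 *
          (|Real.log b| ^ 2 * (Real.log n) ^ 3) := by
        have : c + 1 ≤ (c + 1) ^ 2 := le_self_pow₀ (by linarith) (by norm_num)
        gcongr
      nlinarith [mul_le_mul_of_nonneg_left hlogn hc, mul_le_mul_of_nonneg_left hb1
        (by linarith : 0 ≤ Real.log n)]
    rw [h1, le_div_iff₀ (by positivity), mul_comm]
    have h7 : 0 ≤ c / b + 2 * Real.log n := by positivity
    gcongr
  calc _ = 2 * Real.exp (c / b - 2 * n * ((1 + d) ^ d * (c + 1) * rate d n b) ^ 2 /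
      ((1 / b + d) ^ d) ^ 2) := by rw [sub_eq_add_neg, Real.exp_add]; ring
    _ ≤ 2 * Real.exp (-(2 * Real.log n)) := by gcongr; linarith
    _ = _ := by
        have h : Real.exp (2 * Real.log n) = (n : ℝ) ^ 2 := by
          rw [two_mul, Real.exp_add, Real.exp_log hn0, sq]
        rw [Real.exp_neg, h, one_div]

end

/-! ### Uniform strong consistency -/

section

variable {d : ℕ}

theorem exists_abs_estimator_sub_le (hd : 1 ≤ d) {f : (Fin d → ℝ) → ℝ} (hf : IsDensity f)
    {L : ℝ≥0} (hL : LipschitzOnWith L f (simplex d)) :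
    ∃ C : ℝ, 0 ≤ C ∧ ∀ (Ω : Type u) [MeasurableSpace Ω] (P : Measure Ω) [IsProbabilityMeasure P]
      (X : ℕ → Ω → Fin d → ℝ), IsSample P f X → ∀ b : ℕ → ℝ, Tendsto b atTop (𝓝[>] 0) →
      ∀ᵐ ω ∂P, ∀ᶠ n : ℕ in atTop, ∀ s ∈ shrunkSimplex d (b n * d),
        |estimator X n (b n) ω s - f s| ≤ C * rate d n (b n) + C * √(b n) := by
  obtain ⟨c, hc, hcard⟩ := exists_net_card_le d
  set B : ℝ := L * (d * ((3 + (d + 1) * (d + 2)) / 2 + 1 / 2)) with hB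
  set D : ℝ := (1 + d) ^ d * (c + 1) with hD
  have hB0 : 0 ≤ B := by positivity
  have hD0 : 0 ≤ D := by positivity
  -- `D` is the multiple of the rate at net points and `B` the bias constant. The `2` pays for
  -- moving `f̂` and `f_b` from `s` to a net point, at cost `√b` each.
  refine ⟨D + (B + 2), by positivity, fun Ω _ P _ X hX b hb => ?_⟩
  choose F hFA hFc hFn using fun n => exists_finset_net (d := d)
    (A := shrunkSimplex d (b n * d)) (fun s hs => hs.1)
    (Nat.succ_pos ⌈kernelLip d (b n) / √(b n)⌉₊)
  have hb0 : ∀ᶠ n in atTop, 0 < b n := hb.eventually self_mem_nhdsWithin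
  -- Below `exp (-1)` both `b ≤ 1` and `|log b| ≥ 1` hold.
  have hbe : ∀ᶠ n in atTop, b n < Real.exp (-1) :=
    (tendsto_nhdsWithin_iff.1 hb).1.eventually (gt_mem_nhds (Real.exp_pos _))
  have hlogn : ∀ᶠ n : ℕ in atTop, 1 ≤ Real.log n :=
    (Real.tendsto_log_atTop.comp tendsto_natCast_atTop_atTop).eventually_ge_atTop 1
  have he1 : Real.exp (-1) ≤ 1 := Real.exp_le_one_iff.2 (by norm_num)
  have hA := ae_eventually_notMem_of_eventually_le (P := P)
    (A := fun n => {ω | ∃ s ∈ F n, D * rate d n (b n) ≤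
      |estimator X n (b n) ω s - smoothed f (b n) s|})
    (g := fun n => 2 * (1 / (n : ℝ) ^ 2))
    ((Real.summable_one_div_nat_pow.2 one_lt_two).mul_left 2) (by
      filter_upwards [hb0, hbe, hlogn, eventually_ge_atTop 1] with n h0 h1 h2 h3
      have hb1 : b n ≤ 1 := h1.le.trans he1
      have hlog : 1 ≤ |Real.log (b n)| := by
        have := Real.log_le_log h0 h1.le
        rw [Real.log_exp] at this
        exact le_abs.2 (Or.inr (by linarith))
      refine (measureReal_exists_abs_estimator_sub_ge_le hX h0
        (fun s hs => (hFA n hs).1) h3 (mul_nonneg hD0 (rate_nonneg d n h0))).trans ?_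
      refine le_trans ?_ (exp_mul_tail_le (d := d) h0 hlog hb1 h3 h2 hc)
      gcongr
      refine le_trans ?_ (hcard (b n) h0 hb1)
      exact_mod_cast hFc n)
  filter_upwards [hA, ae_all_iff.2 hX.ae_mem_simplex] with ω hω hXω
  filter_upwards [hω, hb0, hbe, eventually_ge_atTop 1] with n hn h0 h1 h3 s hs
  have hb1 : b n ≤ 1 := h1.le.trans he1
  obtain ⟨s', hs'F, hss'⟩ := hFn n s hs
  have hs' := hFA n hs'F
  have hn' : |estimator X n (b n) ω s' - smoothed f (b n) s'| ≤ D * rate d n (b n) := by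
    by_contra! h
    exact hn ⟨s', hs'F, h.le⟩
  have hsq : 0 < √(b n) := Real.sqrt_pos.2 h0
  have hmesh : kernelLip d (b n) * (1 / ((⌈kernelLip d (b n) / √(b n)⌉₊.succ : ℕ) : ℝ)) ≤
      √(b n) := by
    rw [mul_one_div, div_le_iff₀ (by positivity), ← div_le_iff₀' hsq]
    refine (Nat.le_ceil _).trans ?_
    push_cast
    linarith
  have hker : ∀ x ∈ simplex d, |kernel (b n) s x - kernel (b n) s' x| ≤ √(b n) := fun x hx =>
    (abs_kernel_sub_le hd h0 hb1 hs hs' hss' hx).trans hmesh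
  have e1 := abs_estimator_sub_le (x := X) (ω := ω) h3 fun i => hker _ (hXω i)
  have e2 := abs_smoothed_sub_smoothed_le hf h0 hs.1 hs'.1 hker
  have e3 := abs_smoothed_sub_le hd hL hf h0 hb1 hs.1
  have hr := rate_nonneg d n h0
  have hBr : 0 ≤ (B + 2) * rate d n (b n) := by positivity
  have hDs : 0 ≤ D * √(b n) := by positivity
  rw [abs_le] at *
  constructor <;> nlinarith [e1.1, e1.2, e2.1, e2.2, e3.1, e3.2, hn'.1, hn'.2]

theorem supDist_le {A : Set (Fin d → ℝ)} {g h : (Fin d → ℝ) → ℝ} {c : ℝ}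
    (H : ∀ s ∈ A, |g s - h s| ≤ c) : supDist A g h ≤ ENNReal.ofReal c :=
  iSup₂_le fun s hs => ENNReal.ofReal_le_ofReal (H s hs)

/-- The square of the rate is eventually equal to the quotient of the two sides of the little-o
hypothesis. -/
theorem tendsto_rate {b : ℕ → ℝ} (hb : Tendsto b atTop (𝓝[>] 0))
    (h : (fun n : ℕ => |Real.log (b n)| ^ 2 * (b n) ^ (-2 * (d : ℝ) - 1))
      =o[atTop] (fun n : ℕ => (n : ℝ) / (Real.log n) ^ 3)) :
    Tendsto (fun n => rate d n (b n)) atTop (𝓝 0) := by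
  have hb0 : ∀ᶠ n in atTop, 0 < b n := hb.eventually self_mem_nhdsWithin
  have h1 : (fun n => rate d n (b n)) =ᶠ[atTop] fun n : ℕ =>
      √(|Real.log (b n)| ^ 2 * (b n) ^ (-2 * (d : ℝ) - 1) / ((n : ℝ) / (Real.log n) ^ 3)) := by
    filter_upwards [hb0] with n h0
    rw [← Real.sqrt_sq (rate_nonneg d n h0), rate_sq d n h0]
    congr 1
    have : (b n) ^ (-2 * (d : ℝ) - 1) = ((b n) ^ (2 * d + 1))⁻¹ := by
      rw [← Real.rpow_natCast, ← Real.rpow_neg h0.le]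
      push_cast
      ring_nf
    rw [this, div_div_eq_mul_div]
    field_simp
  rw [tendsto_congr' h1]
  simpa using h.tendsto_div_nhds_zero.sqrt

end

end DirichletKernel

theorem mainTheorem1 (d : ℕ) (hd : 1 ≤ d) (f : (Fin d → ℝ) → ℝ)
    (hf : DirichletKernel.IsDensity f)
    (hLip : ∃ L, LipschitzOnWith L f (DirichletKernel.simplex d)) :
    (∃ C : ℝ, ∀ᶠ b : ℝ in 𝓝[>] 0,
      DirichletKernel.supDist (DirichletKernel.simplex d) (DirichletKernel.smoothed f b) f
        ≤ ENNReal.ofReal (C * b ^ (1 / 2 : ℝ))) ∧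
    (∃ C : ℝ, ∀ (Ω : Type u) [MeasurableSpace Ω] (P : Measure Ω) [IsProbabilityMeasure P]
      (X : ℕ → Ω → Fin d → ℝ), DirichletKernel.IsSample P f X →
      ∀ b : ℕ → ℝ, Tendsto b atTop (𝓝[>] 0) →
      (∀ᶠ n : ℕ in atTop, (b n) ^ (-(d : ℝ)) ≤ (n : ℝ)) →
      ∀ᵐ ω ∂P, ∀ᶠ n : ℕ in atTop,
        DirichletKernel.supDist (DirichletKernel.shrunkSimplex d (b n * d))
            (DirichletKernel.estimator X n (b n) ω) f
          ≤ ENNReal.ofReal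
            (C * (|Real.log (b n)| * (Real.log n) ^ (3 / 2 : ℝ)
                / ((b n) ^ ((d : ℝ) + 1 / 2) * √(n : ℝ)))
              + C * (b n) ^ (1 / 2 : ℝ))) ∧
    (∀ (Ω : Type u) [MeasurableSpace Ω] (P : Measure Ω) [IsProbabilityMeasure P]
      (X : ℕ → Ω → Fin d → ℝ), DirichletKernel.IsSample P f X →
      ∀ b : ℕ → ℝ, Tendsto b atTop (𝓝[>] 0) →
      (fun n : ℕ => |Real.log (b n)| ^ 2 * (b n) ^ (-2 * (d : ℝ) - 1))
        =o[atTop] (fun n : ℕ => (n : ℝ) / (Real.log n) ^ 3) →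
      ∀ᵐ ω ∂P, Tendsto
        (fun n : ℕ => DirichletKernel.supDist (DirichletKernel.shrunkSimplex d (b n * d))
          (DirichletKernel.estimator X n (b n) ω) f) atTop (𝓝 0)) := by
  obtain ⟨L, hL⟩ := hLip
  obtain ⟨C, hC, H⟩ := DirichletKernel.exists_abs_estimator_sub_le.{u} hd hf hL
  refine ⟨⟨L * (d * ((3 + (d + 1) * (d + 2)) / 2 + 1 / 2)), ?_⟩,
    ⟨C, fun Ω _ P _ X hX b hb _ => ?_⟩, fun Ω _ P _ X hX b hb ho => ?_⟩
  · filter_upwards [self_mem_nhdsWithin, nhdsWithin_le_nhds (gt_mem_nhds one_pos)] with b h0 h1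
    refine DirichletKernel.supDist_le fun s hs => ?_
    rw [← Real.sqrt_eq_rpow]
    exact DirichletKernel.abs_smoothed_sub_le hd hL hf h0 h1.le hs
  · filter_upwards [H Ω P X hX b hb] with ω hω
    filter_upwards [hω] with n hn
    refine DirichletKernel.supDist_le fun s hs => ?_
    rw [← Real.sqrt_eq_rpow]
    exact hn s hs
  · filter_upwards [H Ω P X hX b hb] with ω hω
    have hlim : Tendsto (fun n => ENNReal.ofReal (C * DirichletKernel.rate d n (b n) +
        C * √(b n))) atTop (𝓝 0) := by
      have h1 := (DirichletKernel.tendsto_rate hb ho).const_mul C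
      have h2 := ((tendsto_nhdsWithin_iff.1 hb).1.sqrt).const_mul C
      simpa using ENNReal.tendsto_ofReal (h1.add h2)
    refine tendsto_of_tendsto_of_tendsto_of_le_of_le' tendsto_const_nhds hlim
      (Eventually.of_forall fun _ => zero_le) ?_
    filter_upwards [hω] with n hn
    exact DirichletKernel.supDist_le hn
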